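/- Let $p\ge 0$, $\omega_0\in\mathbb R$, and for each $n\ge1$ let $y_{t,n}=\omega_0+x_{t,n}$ for $1-p\le t\le n$, where $$x_{t,n}=\sum_{i=1}^p a_{0i}x_{t-i,n}+u_{t,n},\qquad u_{t,n}=g(t/n)\,\epsilon_t,\qquad 1\le t\le n,$$ and the starting values $x_{0,n},\dots,x_{1-p,n}$ are any random variables that are bounded in probability as $n\to\infty$. Assume: (A0) $1-\sum_{i=1}^p a_{0i}z^i\neq0$ for all complex $|z|\le1$; (A1) (i) $g$ is a bounded measurable function on $(0,1]$, there is $c>0$ with $g(t/n)\ge c$ for all $1\le t\le n$, and $g$ is Lipschitz on each of finitely many intervals (possibly reduced to a point) that partition $(0,1]$; (ii) $(\epsilon_t)$ is iid with $E\epsilon_t=0$, $E\epsilon_t^2=1$ and $E|\epsilon_t|^{8\nu}<\infty$ for some $\nu>1$. Assume that $g$ is not constant, in the sense that it is not almost everywhere equal to a constant on $(0,1]$. Let $\hat\omega=n^{-1}\sum_{t=1}^n y_{t,n}$, $\hat x_t=y_{t,n}-\hat\omega$, $\underline{\hat x}_{t-1}=(\hat x_{t-1},\dots,\hat x_{t-p})'$,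 let $\hat\theta=\big(\sum_{t=1}^n\underline{\hat x}_{t-1}\underline{\hat x}_{t-1}'\big)^{-1}\sum_{t=1}^n\underline{\hat x}_{t-1}\hat x_t$ be the least squares estimator and $\hat u_t=\hat x_t-\hat\theta'\underline{\hat x}_{t-1}$, $1\le t\le n$, the residuals. With $\bar{\hat u}=n^{-1}\sum_{t=1}^n\hat u_t$ and $\hat\mu_j=n^{-1}\sum_{t=1}^n(\hat u_t-\bar{\hat u})^j$, put $$Q^{S,u}_{JB}=\frac{\hat\mu_3^2}{6\hat\mu_2^3},\qquad Q^{K,u}_{JB}=\frac1{24}\Big(\frac{\hat\mu_4}{\hat\mu_2^2}-3\Big)^2,\qquad Q^u_{JB}=n\big[Q^{S,u}_{JB}+Q^{K,u}_{JB}\big],\qquad \kappa_2=\frac{\int_0^1g^4(r)\,dr}{\big(\int_0^1g^2(r)\,dr\big)^2}.$$ Then, as $n\to\infty$: (1) $Q^{K,u}_{JB}=\frac1{24}\big[\kappa_2\,(E\epsilon_t^4-3)+3(\kappa_2-1)\big]^2+o_p(1)$; (2) $\kappa_2>1$, and the limit in (1) is strictly positive whenever $E\epsilon_t^4\ge3$;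 (3) if $E\epsilon_t^4=3$, then there is a constant $C>0$ with $Q^u_{JB}=Cn+o_p(n)$, and $P(Q^u_{JB}>q)\to1$ for every critical value $q\in\mathbb R$; (4) in particular, if $\epsilon_t\sim\mathcal N(0,1)$, then $Q^u_{JB}=Cn+o_p(n)$ with $C=\frac38(\kappa_2-1)^2>0$, and $P(Q^u_{JB}>q)\to1$ for every $q\in\mathbb R$, so the classical test rejects normality spuriously. -/

import Mathlib

open MeasureTheory ProbabilityTheory Filter Topology

noncomputable section

namespace JarqueBera

/-! ### The sample statistics, computed from observations `y t`, `1 - p ≤ t ≤ n` -/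

section Statistics

/-- The empirical mean `n⁻¹ ∑_{t=1}^n y_t`. -/
def omegaHat (n : ℕ) (y : ℤ → ℝ) : ℝ :=
  (n : ℝ)⁻¹ * ∑ t ∈ Finset.Icc 1 n, y (t : ℤ)

/-- The centred observations `x_t(w) = y_t - w`. -/
def xC (y : ℤ → ℝ) (w : ℝ) (t : ℤ) : ℝ := y t - w

/-- The regressor `(x_{t-1}(w), …, x_{t-p}(w))`; the coordinate `i : Fin p` is lag `i + 1`. -/
def lagVec (p : ℕ) (y : ℤ → ℝ) (w : ℝ) (t : ℤ) : Fin p → ℝ :=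
  fun i => xC y w (t - ((i : ℕ) + 1 : ℤ))

/-- `n⁻¹ ∑_{t=1}^n x̲_{t-1}(w) x̲_{t-1}(w)'`. -/
def sigmaLag (p n : ℕ) (y : ℤ → ℝ) (w : ℝ) : Matrix (Fin p) (Fin p) ℝ :=
  (n : ℝ)⁻¹ • ∑ t ∈ Finset.Icc 1 n,
    Matrix.vecMulVec (lagVec p y w (t : ℤ)) (lagVec p y w (t : ℤ))

/-- `n⁻¹ ∑_{t=1}^n x̲_{t-1}(w) x_t(w)`. -/
def sigmaCross (p n : ℕ) (y : ℤ → ℝ) (w : ℝ) : Fin p → ℝ :=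
  (n : ℝ)⁻¹ • ∑ t ∈ Finset.Icc 1 n, xC y w (t : ℤ) • lagVec p y w (t : ℤ)

/-- The least squares estimator `θ̂(w)` of the autoregressive parameters. -/
def thetaHat (p n : ℕ) (y : ℤ → ℝ) (w : ℝ) : Fin p → ℝ :=
  Matrix.mulVec (sigmaLag p n y w)⁻¹ (sigmaCross p n y w)

/-- The residuals `û_t = x_t(ω̂) - ∑_i θ̂_i(ω̂) x_{t-i}(ω̂)`. -/
def uHat (p n : ℕ) (y : ℤ → ℝ) (t : ℤ) : ℝ :=
  xC y (omegaHat n y) t -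
    ∑ i : Fin p, thetaHat p n y (omegaHat n y) i * lagVec p y (omegaHat n y) t i

/-- The mean of the residuals. -/
def uBar (p n : ℕ) (y : ℤ → ℝ) : ℝ :=
  (n : ℝ)⁻¹ * ∑ t ∈ Finset.Icc 1 n, uHat p n y (t : ℤ)

/-- The empirical centred moment `μ̂_j` of the residuals. -/
def muHat (p n : ℕ) (y : ℤ → ℝ) (j : ℕ) : ℝ :=
  (n : ℝ)⁻¹ * ∑ t ∈ Finset.Icc 1 n, (uHat p n y (t : ℤ) - uBar p n y) ^ j

/-- The skewness part of the classical statistic. -/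
def QS (p n : ℕ) (y : ℤ → ℝ) : ℝ :=
  muHat p n y 3 ^ 2 / (6 * muHat p n y 2 ^ 3)

/-- The kurtosis part of the classical statistic. -/
def QK (p n : ℕ) (y : ℤ → ℝ) : ℝ :=
  1 / 24 * (muHat p n y 4 / muHat p n y 2 ^ 2 - 3) ^ 2

/-- The classical Jarque-Bera statistic of the raw residuals. -/
def QJB (p n : ℕ) (y : ℤ → ℝ) : ℝ := n * (QS p n y + QK p n y)

end Statistics

/-! ### Assumptions and model -/

/-- Stability: `1 - ∑_{i=1}^p a_i z^i ≠ 0` on the closed complex unit disc. -/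
def AssumptionA0 {p : ℕ} (a : Fin p → ℝ) : Prop :=
  ∀ z : ℂ, ‖z‖ ≤ 1 → 1 - ∑ i : Fin p, (a i : ℂ) * z ^ ((i : ℕ) + 1) ≠ 0

/-- `g` is Lipschitz on each of finitely many intervals (possibly reduced to a point) that
partition `(0,1]`. -/
def PiecewiseLipschitz (g : ℝ → ℝ) : Prop :=
  ∃ (m : ℕ) (I : Fin m → Set ℝ),
    (∀ j, (I j).OrdConnected) ∧
    Pairwise (fun j k => Disjoint (I j) (I k)) ∧
    (⋃ j, I j) = Set.Ioc (0 : ℝ) 1 ∧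
    ∀ j, ∃ K : NNReal, LipschitzOnWith K g (I j)

/-- The conditions on the volatility function; only the values of `g` on `(0,1]` matter. -/
structure AssumptionA1i (g : ℝ → ℝ) : Prop where
  lower : ∃ c : ℝ, 0 < c ∧ ∀ n t : ℕ, 1 ≤ t → t ≤ n → c ≤ g ((t : ℝ) / n)
  measurable : Measurable ((Set.Ioc (0 : ℝ) 1).domRestrict g)
  bounded : ∃ M : ℝ, ∀ r ∈ Set.Ioc (0 : ℝ) 1, |g r| ≤ M
  lipschitz : PiecewiseLipschitz g

/-- The innovations are iid, centred, of unit variance, with a moment of order above `8`. -/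
structure AssumptionA1ii {Ω : Type*} [MeasurableSpace Ω] (P : Measure Ω) (ε : ℕ → Ω → ℝ) :
    Prop where
  measurable : ∀ t, Measurable (ε t)
  indep : iIndepFun ε P
  ident : ∀ s t, IdentDistrib (ε s) (ε t) P P
  mean : ∀ t, ∫ ω, ε t ω ∂P = 0
  variance : ∀ t, ∫ ω, ε t ω ^ 2 ∂P = 1
  moment : ∃ ν : ℝ, 1 < ν ∧ ∀ t, Integrable (fun ω => |ε t ω| ^ (8 * ν)) P

/-- `Z_n = O_p(1)`. -/
def BoundedInProbability {Ω : Type*} [MeasurableSpace Ω] (P : Measure Ω) (Z : ℕ → Ω → ℝ) :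
    Prop :=
  ∀ δ : ℝ, 0 < δ → ∃ M : ℝ, ∀ᶠ n in atTop, P {ω | M < |Z n ω|} ≤ ENNReal.ofReal δ

/-- `y n t = ω₀ + x n t` where `x n t = ∑_i a_i x n (t - i) + g (t / n) ε_t` for `1 ≤ t ≤ n`;
the starting values (`1 - p ≤ t ≤ 0`) are random variables that are bounded in probability. -/
structure IsHeteroscedasticAR {Ω : Type*} [MeasurableSpace Ω] (P : Measure Ω) {p : ℕ}
    (ω₀ : ℝ) (a : Fin p → ℝ) (g : ℝ → ℝ) (ε : ℕ → Ω → ℝ) (y : ℕ → ℤ → Ω → ℝ) : Prop where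
  recursion : ∀ n t : ℕ, 1 ≤ t → t ≤ n → ∀ ω,
    y n (t : ℤ) ω - ω₀ =
      ∑ i : Fin p, a i * (y n ((t : ℤ) - ((i : ℕ) + 1 : ℤ)) ω - ω₀) +
        g ((t : ℝ) / n) * ε t ω
  start_measurable : ∀ n, ∀ j : Fin p, Measurable (y n (-((j : ℕ) : ℤ)))
  start_bounded : ∀ j : Fin p, BoundedInProbability P (fun n => y n (-((j : ℕ) : ℤ)))

/-- `κ₂ = ∫₀¹ g⁴ / (∫₀¹ g²)²`. -/
def kappa2 (g : ℝ → ℝ) : ℝ :=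
  (∫ r in (0 : ℝ)..1, g r ^ 4) / (∫ r in (0 : ℝ)..1, g r ^ 2) ^ 2

/-- The limit of the kurtosis part when `E ε⁴ = m₄`. -/
def kurtosisLimit (g : ℝ → ℝ) (m₄ : ℝ) : ℝ :=
  1 / 24 * (kappa2 g * (m₄ - 3) + 3 * (kappa2 g - 1)) ^ 2

end JarqueBera

end

/-! The residuals differ from the errors u_t = g(t/n) ε_t, up to a constant removed by centring, by
a term that is negligible in sample moments. Hence μ̂_j tends in probability to (∫ g^j) E ε^j for j
= 2, 3, 4, and μ̂_4/μ̂_2² - 3 tends to κ₂ E ε⁴ - 3 = κ₂ (E ε⁴ - 3) + 3 (κ₂ - 1). Changing variance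
alone inflates the kurtosis: κ₂ - 1 is the variance of g² over (0,1] divided by its squared mean,
which is positive because g is essentially positive and not constant. A positive limit of Q/n then
gives both linear growth and certain rejection.

Convergence in probability is expressed as `Tendsto` along the filter `inProb` on pairs (n, ω), so
Slutsky and continuous mapping arguments become ordinary limit algebra. Probability enters through
the starting values and two laws of large numbers, `tendsto_avg_err_pow` and
`tendsto_avg_err_mul_of_lt`, which are Chebyshev bounds for uncorrelated arrays, the first combined
with a Riemann sum. The autoregressive part is deterministic and holds along any filter under
`IsAsymptoticAR`.

Stability makes the lag polynomial invertible with an absolutely summable inverse ψ. Thus x is the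
convolution of ψ with the errors, up to starting values, and Young's inequality in ℓ⁴ controls both
parts. Fourth sample moments are the natural scale: μ̂_4 needs them, and they dominate the lower
ones.

Consistency of least squares avoids computing the limit of the Gram matrix. Lagged errors serve as
instruments: their cross moments with the regressors converge to a lower triangular matrix with
diagonal σ₂ > 0. By Cauchy-Schwarz (`crossMoment_mulVec_sq_le`) this forces the Gram matrix to be
invertible and bounds the estimation error by the right side of the normal equations, which vanishes
(`sum_sq_le_of_crossMoment`). -/

noncomputable section

namespace JarqueBera

/-! ### Sample averages -/

section Averages

/-- The sample average `n⁻¹ ∑_{t=1}^n f t`. -/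
def avg (n : ℕ) (f : ℤ → ℝ) : ℝ := (n : ℝ)⁻¹ * ∑ t ∈ Finset.Icc 1 n, f (t : ℤ)

lemma avg_congr {n : ℕ} {f g : ℤ → ℝ} (h : ∀ t : ℕ, 1 ≤ t → t ≤ n → f t = g t) :
    avg n f = avg n g := by
  unfold avg
  congr 1
  refine Finset.sum_congr rfl fun t ht => ?_
  rw [Finset.mem_Icc] at ht
  exact h t ht.1 ht.2

lemma avg_add (n : ℕ) (f g : ℤ → ℝ) : avg n (fun t => f t + g t) = avg n f + avg n g := by
  simp only [avg, Finset.sum_add_distrib, mul_add]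

lemma avg_sub (n : ℕ) (f g : ℤ → ℝ) : avg n (fun t => f t - g t) = avg n f - avg n g := by
  simp only [avg, Finset.sum_sub_distrib, mul_sub]

lemma avg_const_mul (n : ℕ) (c : ℝ) (f : ℤ → ℝ) :
    avg n (fun t => c * f t) = c * avg n f := by
  simp only [avg, ← Finset.mul_sum]
  ring

lemma avg_const {n : ℕ} (hn : n ≠ 0) (c : ℝ) : avg n (fun _ => c) = c := by
  have : (n : ℝ) ≠ 0 := by exact_mod_cast hn
  simp [avg, this]

lemma avg_sum {ι : Type*} (n : ℕ) (s : Finset ι) (f : ι → ℤ → ℝ) :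
    avg n (fun t => ∑ i ∈ s, f i t) = ∑ i ∈ s, avg n (f i) := by
  simp only [avg]
  rw [Finset.sum_comm, Finset.mul_sum]

lemma avg_mono {n : ℕ} {f g : ℤ → ℝ} (h : ∀ t : ℕ, 1 ≤ t → t ≤ n → f t ≤ g t) :
    avg n f ≤ avg n g := by
  unfold avg
  gcongr with t ht
  rw [Finset.mem_Icc] at ht
  exact h t ht.1 ht.2

lemma avg_nonneg {n : ℕ} {f : ℤ → ℝ} (h : ∀ t, 0 ≤ f t) : 0 ≤ avg n f := by
  unfold avg
  have := Finset.sum_nonneg fun t (_ : t ∈ Finset.Icc 1 n) => h (t : ℤ)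
  positivity

/-- The Cauchy-Schwarz inequality for sample averages. -/
lemma avg_mul_sq_le (n : ℕ) (f g : ℤ → ℝ) :
    avg n (fun t => f t * g t) ^ 2 ≤ avg n (fun t => f t ^ 2) * avg n (fun t => g t ^ 2) := by
  have h := Finset.sum_mul_sq_le_sq_mul_sq (Finset.Icc 1 n)
    (fun t : ℕ => f (t : ℤ)) (fun t : ℕ => g (t : ℤ))
  simp only [avg, mul_pow]
  calc _ ≤ ((n : ℝ)⁻¹) ^ 2 * ((∑ t ∈ Finset.Icc 1 n, f (t : ℤ) ^ 2) *
        ∑ t ∈ Finset.Icc 1 n, g (t : ℤ) ^ 2) := by gcongr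
    _ = _ := by ring

lemma avg_sq_sq_le {n : ℕ} (hn : n ≠ 0) (f : ℤ → ℝ) :
    avg n (fun t => f t ^ 2) ^ 2 ≤ avg n (fun t => f t ^ 4) := by
  have h := avg_mul_sq_le n (fun t => f t ^ 2) (fun _ => 1)
  simp only [mul_one, one_pow, avg_const hn] at h
  refine h.trans (le_of_eq ?_)
  congr 1
  ext t
  ring

lemma avg_sq_le {n : ℕ} (hn : n ≠ 0) (f : ℤ → ℝ) :
    avg n f ^ 2 ≤ avg n (fun t => f t ^ 2) := by
  have h := avg_mul_sq_le n f (fun _ => 1)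
  simpa only [mul_one, one_pow, avg_const hn] using h

/-- The two sums telescope, leaving only the end terms. -/
lemma avg_shift_sub (n : ℕ) (f : ℤ → ℝ) (m : ℤ) :
    avg n (fun t => f (t - m)) - avg n (fun t => f (t - (m + 1))) =
      (n : ℝ)⁻¹ * (f (n - m) - f (-m)) := by
  rw [← avg_sub, avg]
  congr 1
  induction n with
  | zero => simp
  | succ k ih =>
    rw [Finset.sum_Icc_succ_top (by omega), ih]
    push_cast
    rw [show (k : ℤ) + 1 - (m + 1) = k - m by ring]
    ring

end Averages

/-! ### Limits of sample averages along a filter -/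

section AverageLimits

variable {Q : Type*} {L : Filter Q} {N : Q → ℕ}

lemma tendsto_zero_of_sq {f : Q → ℝ} (h : Tendsto (fun q => f q ^ 2) L (𝓝 0)) :
    Tendsto f L (𝓝 0) := by
  have h1 : Tendsto (fun q => √(f q ^ 2)) L (𝓝 0) := by simpa using h.sqrt
  simp only [Real.sqrt_sq_eq_abs] at h1
  exact (tendsto_zero_iff_abs_tendsto_zero f).2 h1

lemma tendsto_zero_of_sq_le {f b : Q → ℝ} (hb : Tendsto b L (𝓝 0))
    (h : ∀ᶠ q in L, f q ^ 2 ≤ b q) : Tendsto f L (𝓝 0) :=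
  tendsto_zero_of_sq
    (squeeze_zero' (Eventually.of_forall fun q => sq_nonneg (f q)) h hb)

/-- Cauchy-Schwarz: bounded second moment times vanishing second moment. This is the basic tool for
discarding cross terms. -/
lemma tendsto_avg_mul_zero {f g : Q → ℤ → ℝ} {α : ℝ}
    (hf : Tendsto (fun q => avg (N q) (fun t => f q t ^ 2)) L (𝓝 α))
    (hg : Tendsto (fun q => avg (N q) (fun t => g q t ^ 2)) L (𝓝 0)) :
    Tendsto (fun q => avg (N q) (fun t => f q t * g q t)) L (𝓝 0) := by
  refine tendsto_zero_of_sq_le (b := fun q => avg (N q) (fun t => f q t ^ 2) *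
    avg (N q) (fun t => g q t ^ 2)) ?_ (Eventually.of_forall fun q => avg_mul_sq_le _ _ _)
  simpa using hf.mul hg

lemma tendsto_avg_sq_zero (hN : Tendsto N L atTop) {f : Q → ℤ → ℝ}
    (hf : Tendsto (fun q => avg (N q) (fun t => f q t ^ 4)) L (𝓝 0)) :
    Tendsto (fun q => avg (N q) (fun t => f q t ^ 2)) L (𝓝 0) :=
  tendsto_zero_of_sq_le hf
    ((hN.eventually_ne_atTop 0).mono fun q hq => avg_sq_sq_le hq (f q))

lemma tendsto_avg_zero (hN : Tendsto N L atTop) {f : Q → ℤ → ℝ}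
    (hf : Tendsto (fun q => avg (N q) (fun t => f q t ^ 2)) L (𝓝 0)) :
    Tendsto (fun q => avg (N q) (f q)) L (𝓝 0) :=
  tendsto_zero_of_sq_le hf
    ((hN.eventually_ne_atTop 0).mono fun q hq => avg_sq_le hq (f q))

lemma tendsto_natCast_inv (hN : Tendsto N L atTop) :
    Tendsto (fun q => (N q : ℝ)⁻¹) L (𝓝 0) :=
  tendsto_inv_atTop_nhds_zero_nat.comp hN

/-- Consecutive shifts of a sequence with bounded sample second moment have asymptotically equal
averages. -/
lemma tendsto_avg_shift (hN : Tendsto N L atTop) {f : Q → ℤ → ℝ} {V : Q → ℝ} {β : ℝ} (m : ℕ)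
    (hV : Tendsto V L (𝓝 β))
    (hfV : ∀ᶠ q in L, avg (N q) (fun t => f q (t - m) ^ 2) ≤ V q)
    (h0 : Tendsto (fun q => (N q : ℝ)⁻¹ * f q (-(m : ℤ))) L (𝓝 0)) :
    Tendsto (fun q => avg (N q) (fun t => f q (t - m)) -
      avg (N q) (fun t => f q (t - (m + 1 : ℤ)))) L (𝓝 0) := by
  -- One squared summand is at most N times the average of squares, so the last term divided by N
  -- has square at most V/N.
  have h1 : Tendsto (fun q => (N q : ℝ)⁻¹ * f q (N q - m)) L (𝓝 0) := by
    refine tendsto_zero_of_sq_le (b := fun q => (N q : ℝ)⁻¹ * V q) ?_ ?_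
    · simpa using (tendsto_natCast_inv hN).mul hV
    · filter_upwards [hfV, hN.eventually_ge_atTop 1] with q hq hq1
      rw [mul_pow, sq, mul_assoc]
      gcongr
      refine le_trans ?_ hq
      unfold avg
      gcongr
      exact Finset.single_le_sum (f := fun t : ℕ => f q ((t : ℤ) - m) ^ 2)
        (fun t _ => sq_nonneg _) (Finset.mem_Icc.2 ⟨hq1, le_rfl⟩)
  have h2 := h1.sub h0
  rw [sub_zero] at h2
  refine h2.congr fun q => ?_
  rw [avg_shift_sub]
  ring

lemma add_pow_four_le (a b : ℝ) : (a + b) ^ 4 ≤ 8 * (a ^ 4 + b ^ 4) := by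
  nlinarith [sq_nonneg (a - b), sq_nonneg (a ^ 2 - b ^ 2), sq_nonneg (a + b),
    mul_nonneg (sq_nonneg (a - b)) (sq_nonneg (a + b)), sq_nonneg ((a - b) ^ 2)]

lemma tendsto_avg_add_pow_four_zero {f g : Q → ℤ → ℝ}
    (hf : Tendsto (fun q => avg (N q) (fun t => f q t ^ 4)) L (𝓝 0))
    (hg : Tendsto (fun q => avg (N q) (fun t => g q t ^ 4)) L (𝓝 0)) :
    Tendsto (fun q => avg (N q) (fun t => (f q t + g q t) ^ 4)) L (𝓝 0) := by
  refine squeeze_zero (g := fun q => 8 * (avg (N q) (fun t => f q t ^ 4) +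
    avg (N q) (fun t => g q t ^ 4))) (fun q => avg_nonneg fun t => by positivity) (fun q => ?_) ?_
  · rw [← avg_add, ← avg_const_mul]
    refine avg_mono fun t _ _ => ?_
    exact add_pow_four_le _ _
  · simpa using (hf.add hg).const_mul 8

lemma tendsto_avg_sum_pow_four_zero {ι : Type*} (s : Finset ι) {f : ι → Q → ℤ → ℝ}
    (hf : ∀ i ∈ s, Tendsto (fun q => avg (N q) (fun t => f i q t ^ 4)) L (𝓝 0)) :
    Tendsto (fun q => avg (N q) (fun t => (∑ i ∈ s, f i q t) ^ 4)) L (𝓝 0) := by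
  classical
  induction s using Finset.induction_on with
  | empty => simpa [avg] using tendsto_const_nhds
  | insert i s hi ih =>
    simp only [Finset.sum_insert hi]
    exact tendsto_avg_add_pow_four_zero (hf i (by simp)) (ih fun j hj => hf j (by simp [hj]))

/-- Sample moments are not changed by a perturbation that is negligible in the fourth sample
moment. -/
lemma tendsto_avg_sub_pow (hN : Tendsto N L atTop) {u f : Q → ℤ → ℝ} {α₂ α₄ : ℝ}
    (h2 : Tendsto (fun q => avg (N q) (fun t => u q t ^ 2)) L (𝓝 α₂))
    (h4 : Tendsto (fun q => avg (N q) (fun t => u q t ^ 4)) L (𝓝 α₄))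
    (hf : Tendsto (fun q => avg (N q) (fun t => f q t ^ 4)) L (𝓝 0)) {j : ℕ} {α : ℝ}
    (hj2 : 2 ≤ j) (hj4 : j ≤ 4)
    (hj : Tendsto (fun q => avg (N q) (fun t => u q t ^ j)) L (𝓝 α)) :
    Tendsto (fun q => avg (N q) (fun t => (u q t - f q t) ^ j)) L (𝓝 α) := by
  have f2 := tendsto_avg_sq_zero hN hf
  have f4 : Tendsto (fun q => avg (N q) (fun t => (f q t ^ 2) ^ 2)) L (𝓝 0) := by
    simpa only [← pow_mul] using hf
  have u4 : Tendsto (fun q => avg (N q) (fun t => (u q t ^ 2) ^ 2)) L (𝓝 α₄) := by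
    simpa only [← pow_mul] using h4
  have uf := tendsto_avg_mul_zero h2 f2
  have u2f := tendsto_avg_mul_zero u4 f2
  have uf2 := tendsto_avg_mul_zero h2 f4
  have ff2 := tendsto_avg_mul_zero f2 f4
  have u2f2 := tendsto_avg_mul_zero u4 f4
  have ufsq : Tendsto (fun q => avg (N q) (fun t => (u q t * f q t) ^ 2)) L (𝓝 0) := by
    simpa only [mul_pow] using u2f2
  have uff2 := tendsto_avg_mul_zero ufsq f4
  have u2uf := tendsto_avg_mul_zero u4 ufsq
  -- Binomial expansion: every term other than u^j contains a factor f and is one of the vanishing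
  -- averages above.
  interval_cases j
  · have := (hj.add (uf.const_mul (-2))).add f2
    simp only [mul_zero, add_zero, ← avg_const_mul, ← avg_add] at this
    refine this.congr fun q => ?_
    congr 1
    ext t
    ring
  · have := ((hj.add (u2f.const_mul (-3))).add (uf2.const_mul 3)).add (ff2.const_mul (-1))
    simp only [mul_zero, add_zero, ← avg_const_mul, ← avg_add] at this
    refine this.congr fun q => ?_
    congr 1
    ext t
    ring
  · have := (((hj.add (u2uf.const_mul (-4))).add (u2f2.const_mul 6)).add
      (uff2.const_mul (-4))).add f4
    simp only [mul_zero, add_zero, ← avg_const_mul, ← avg_add] at this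
    refine this.congr fun q => ?_
    congr 1
    ext t
    ring

end AverageLimits

/-! ### The impulse response of a stable autoregression -/

section ImpulseResponse

open Polynomial in
/-- A product of linear factors with roots outside the closed unit disc has an absolutely summable
formal inverse. -/
lemma exists_summable_inverse_prod (s : Multiset ℂ) (hs : ∀ r ∈ s, 1 < ‖r‖) :
    ∃ q : PowerSeries ℂ, (((s.map fun r => X - C r).prod : ℂ[X]) : PowerSeries ℂ) * q = 1 ∧
      Summable fun k => ‖PowerSeries.coeff k q‖ := by
  induction s using Multiset.induction_on with
  | empty =>
    refine ⟨1, by simp, summable_of_ne_finset_zero (s := {0}) fun k hk => ?_⟩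
    have : k ≠ 0 := by simpa using hk
    simp [PowerSeries.coeff_one, this]
  | cons r s ih =>
    obtain ⟨q, hq, hsum⟩ := ih fun z hz => hs z (by simp [hz])
    have hr : 1 < ‖r‖ := hs r (by simp)
    have hr0 : r ≠ 0 := by
      rintro rfl
      simp at hr
      linarith
    -- The geometric expansion of 1/(X - r) at 0, absolutely summable because |r| > 1.
    let e : PowerSeries ℂ := PowerSeries.mk fun k => -(r⁻¹) ^ (k + 1)
    have he : ((X - C r : ℂ[X]) : PowerSeries ℂ) * e = 1 := by
      ext k
      rw [Polynomial.coe_sub, Polynomial.coe_X, Polynomial.coe_C, sub_mul, map_sub,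
        PowerSeries.coeff_C_mul]
      cases k with
      | zero =>
        rw [PowerSeries.coeff_zero_X_mul]
        simp [e, hr0]
      | succ k =>
        rw [PowerSeries.coeff_succ_X_mul]
        simp only [e, PowerSeries.coeff_mk, PowerSeries.coeff_one, Nat.succ_ne_zero, if_false]
        rw [pow_succ r⁻¹ (k + 1)]
        linear_combination (r⁻¹) ^ (k + 1) * mul_inv_cancel₀ hr0
    have hesum : Summable fun k => ‖PowerSeries.coeff k e‖ := by
      have h1 : ‖r⁻¹‖ < 1 := by
        rw [norm_inv]
        exact inv_lt_one_of_one_lt₀ hr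
      refine ((summable_geometric_of_lt_one (norm_nonneg _) h1).mul_right ‖r⁻¹‖).congr fun k => ?_
      rw [PowerSeries.coeff_mk, norm_neg, norm_pow, pow_succ]
    refine ⟨e * q, ?_, ?_⟩
    · rw [Multiset.map_cons, Multiset.prod_cons, Polynomial.coe_mul,
        mul_mul_mul_comm, he, hq, one_mul]
    · simp only [PowerSeries.coeff_mul]
      exact summable_norm_sum_mul_antidiagonal_of_summable_norm
        (f := fun k => PowerSeries.coeff k e) (g := fun k => PowerSeries.coeff k q) hesum hsum

variable {p : ℕ}

-- Over ℂ the polynomial is its leading coefficient times linear factors, all with roots outside the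
-- closed disc.
open Polynomial in
lemma exists_summable_inverse_of_roots (f : ℂ[X]) (hf : ∀ z : ℂ, ‖z‖ ≤ 1 → f.eval z ≠ 0) :
    ∃ q : PowerSeries ℂ, (f : PowerSeries ℂ) * q = 1 ∧
      Summable fun k => ‖PowerSeries.coeff k q‖ := by
  have hf0 : f ≠ 0 := by
    rintro rfl
    exact hf 0 (by simp) (by simp)
  obtain ⟨q, hq, hsum⟩ := exists_summable_inverse_prod f.roots fun r hr => by
    by_contra! h
    exact hf r h (Polynomial.isRoot_of_mem_roots hr)
  have hlead : f.leadingCoeff ≠ 0 := by simpa using hf0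
  refine ⟨PowerSeries.C f.leadingCoeff⁻¹ * q, ?_, ?_⟩
  · have hfac := congrArg (fun h : ℂ[X] => (h : PowerSeries ℂ))
      (IsAlgClosed.splits f).eq_prod_roots
    simp only [Polynomial.coe_mul, Polynomial.coe_C] at hfac
    rw [hfac, mul_mul_mul_comm, hq, ← map_mul, mul_inv_cancel₀ hlead, map_one, one_mul]
  · simp only [PowerSeries.coeff_C_mul, norm_mul]
    exact hsum.mul_left _

/-- The lag polynomial as a formal power series. -/
def lagSeries (a : Fin p → ℝ) : PowerSeries ℝ :=
  1 - ∑ i : Fin p, PowerSeries.C (a i) * PowerSeries.X ^ ((i : ℕ) + 1)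

lemma coeff_lagSeries_mul (a : Fin p → ℝ) (f : PowerSeries ℝ) (k : ℕ) :
    PowerSeries.coeff k (lagSeries a * f) = PowerSeries.coeff k f -
      ∑ i : Fin p, a i * if (i : ℕ) + 1 ≤ k then PowerSeries.coeff (k - (i + 1)) f else 0 := by
  simp only [lagSeries, sub_mul, one_mul, map_sub, Finset.sum_mul, map_sum, mul_assoc,
    PowerSeries.coeff_C_mul, PowerSeries.coeff_X_pow_mul']

/-- A stable autoregression has an absolutely summable impulse response. -/
lemma exists_summable_inverse {a : Fin p → ℝ} (ha : AssumptionA0 a) :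
    ∃ ψ : PowerSeries ℝ, lagSeries a * ψ = 1 ∧ Summable fun k => |PowerSeries.coeff k ψ| := by
  classical
  obtain ⟨q, hq, hsum⟩ := exists_summable_inverse_of_roots
    (1 - ∑ i : Fin p, Polynomial.C (a i : ℂ) * Polynomial.X ^ ((i : ℕ) + 1)) (fun z hz => by
      have := ha z hz
      simpa [Polynomial.eval_finsetSum] using this)
  -- The lag polynomial is real, so the coefficientwise real part of a complex inverse is again an
  -- inverse, with no larger coefficients.
  refine ⟨PowerSeries.mk fun k => (PowerSeries.coeff k q).re, ?_, ?_⟩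
  · ext k
    rw [coeff_lagSeries_mul]
    have h := congrArg (fun s => (PowerSeries.coeff k s).re) hq
    have hcoe : ((1 - ∑ i : Fin p, Polynomial.C (a i : ℂ) * Polynomial.X ^ ((i : ℕ) + 1) :
        Polynomial ℂ) : PowerSeries ℂ) =
        1 - ∑ i : Fin p, PowerSeries.C (a i : ℂ) * PowerSeries.X ^ ((i : ℕ) + 1) := by
      rw [Polynomial.coe_sub, Polynomial.coe_one]
      congr 1
      rw [← Polynomial.coeToPowerSeries.ringHom_apply, map_sum]
      simp
    simp only [hcoe, sub_mul, one_mul, map_sub, Finset.sum_mul, map_sum, mul_assoc,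
      PowerSeries.coeff_C_mul, PowerSeries.coeff_X_pow_mul', Complex.sub_re, Complex.re_sum,
      Complex.re_ofReal_mul] at h
    simp only [PowerSeries.coeff_mk]
    have h1 : (PowerSeries.coeff k (1 : PowerSeries ℂ)).re =
        PowerSeries.coeff k (1 : PowerSeries ℝ) := by
      simp only [PowerSeries.coeff_one]
      split_ifs <;> simp
    rw [h1] at h
    rw [← h]
    congr 1
    refine Finset.sum_congr rfl fun i _ => ?_
    split_ifs <;> simp
  · refine Summable.of_nonneg_of_le (fun _ => abs_nonneg _) (fun k => ?_) hsum
    rw [PowerSeries.coeff_mk]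
    exact Complex.abs_re_le_norm _

/-- The causal convolution of `ψ` with the values of `f` at positive times. -/
def conv (ψ : ℕ → ℝ) (f : ℤ → ℝ) (s : ℤ) : ℝ :=
  ∑ k ∈ Finset.range s.toNat, ψ k * f (s - k)

lemma conv_of_nonpos (ψ : ℕ → ℝ) (f : ℤ → ℝ) {s : ℤ} (hs : s ≤ 0) : conv ψ f s = 0 := by
  simp [conv, Int.toNat_of_nonpos hs]

lemma conv_add (ψ : ℕ → ℝ) (f g : ℤ → ℝ) (s : ℤ) :
    conv ψ (fun t => f t + g t) s = conv ψ f s + conv ψ g s := by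
  simp only [conv, mul_add, Finset.sum_add_distrib]

lemma conv_congr (ψ : ℕ → ℝ) {f g : ℤ → ℝ} {s : ℤ} (h : ∀ t, 1 ≤ t → t ≤ s → f t = g t) :
    conv ψ f s = conv ψ g s := by
  refine Finset.sum_congr rfl fun k hk => ?_
  rw [Finset.mem_range] at hk
  rw [h _ (by omega) (by omega)]

/-- Inversion of the lag polynomial. -/
lemma eq_conv_of_lagSeries_mul_eq_one {a : Fin p → ℝ} {ψ : PowerSeries ℝ}
    (hψ : lagSeries a * ψ = 1) {x : ℤ → ℝ} (hx : ∀ s ≤ 0, x s = 0) (s : ℤ) :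
    x s = conv (fun k => PowerSeries.coeff k ψ)
      (fun t => x t - ∑ i : Fin p, a i * x (t - ((i : ℕ) + 1 : ℤ))) s := by
  rcases le_or_gt s 0 with hs | hs
  · rw [hx s hs, conv_of_nonpos _ _ hs]
  lift s to ℕ using hs.le
  let X : PowerSeries ℝ := PowerSeries.mk fun k => x k
  have hX : X = ψ * (lagSeries a * X) := by
    rw [← mul_assoc, mul_comm ψ, hψ, one_mul]
  have hc : ∀ k : ℕ, PowerSeries.coeff k (lagSeries a * X) =
      x k - ∑ i : Fin p, a i * x ((k : ℤ) - ((i : ℕ) + 1 : ℤ)) := fun k => by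
    rw [coeff_lagSeries_mul]
    simp only [X, PowerSeries.coeff_mk]
    congr 1
    refine Finset.sum_congr rfl fun i _ => ?_
    split_ifs with h
    · congr 2
      push_cast [Nat.cast_sub h]
      ring
    · rw [hx _ (by omega)]
  have h := congrArg (PowerSeries.coeff s) hX
  rw [PowerSeries.coeff_mul, Finset.Nat.sum_antidiagonal_eq_sum_range_succ_mk] at h
  simp only [hc] at h
  rw [Finset.sum_range_succ] at h
  simp only [X, PowerSeries.coeff_mk] at h
  -- The Cauchy product has one more term than `conv`, namely k = s. It samples the filtered
  -- sequence at time 0, where it is zero.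
  have hz : x ((s - s : ℕ) : ℤ) -
      ∑ i : Fin p, a i * x (((s - s : ℕ) : ℤ) - ((i : ℕ) + 1 : ℤ)) = 0 := by
    rw [hx _ (by simp), Finset.sum_eq_zero, sub_zero]
    intro i _
    rw [hx _ (by simp), mul_zero]
  rw [hz, mul_zero, add_zero] at h
  rw [h, conv, Int.toNat_natCast]
  refine Finset.sum_congr rfl fun k hk => ?_
  rw [Finset.mem_range] at hk
  rw [Nat.cast_sub hk.le]

/-- Jensen's inequality for a finite weighted sum. -/
lemma sum_mul_sq_le_abs {ι : Type*} (s : Finset ι) (w f : ι → ℝ) :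
    (∑ k ∈ s, w k * f k) ^ 2 ≤ (∑ k ∈ s, |w k|) * ∑ k ∈ s, |w k| * f k ^ 2 := by
  refine Finset.sum_sq_le_sum_mul_sum_of_sq_le_mul s (fun _ _ => abs_nonneg _)
    (fun _ _ => by positivity) fun i _ => ?_
  rw [mul_pow, ← sq_abs (w i)]
  exact le_of_eq (by ring)

/-- Weighted Jensen for squares, applied twice. -/
lemma sum_mul_pow_four_le_abs {ι : Type*} (s : Finset ι) (w f : ι → ℝ) :
    (∑ k ∈ s, w k * f k) ^ 4 ≤ (∑ k ∈ s, |w k|) ^ 3 * ∑ k ∈ s, |w k| * f k ^ 4 := by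
  have h1 := sum_mul_sq_le_abs s w f
  have h2 := sum_mul_sq_le_abs s (fun k => |w k|) (fun k => f k ^ 2)
  simp only [abs_abs, ← pow_mul] at h2
  have h0 : 0 ≤ ∑ k ∈ s, |w k| := Finset.sum_nonneg fun _ _ => abs_nonneg _
  calc (∑ k ∈ s, w k * f k) ^ 4 = ((∑ k ∈ s, w k * f k) ^ 2) ^ 2 := by ring
    _ ≤ ((∑ k ∈ s, |w k|) * ∑ k ∈ s, |w k| * f k ^ 2) ^ 2 := by gcongr
    _ = (∑ k ∈ s, |w k|) ^ 2 * (∑ k ∈ s, |w k| * f k ^ 2) ^ 2 := by ring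
    _ ≤ (∑ k ∈ s, |w k|) ^ 2 * ((∑ k ∈ s, |w k|) * ∑ k ∈ s, |w k| * f k ^ 4) := by gcongr
    _ = _ := by ring

/-- Each unit shift brings a zero into the window and drops the nonnegative term f(n - m). -/
lemma sum_shift_le {f : ℤ → ℝ} (hf : ∀ s, 0 ≤ f s) (hf0 : ∀ s ≤ 0, f s = 0) (n m : ℕ) :
    ∑ t ∈ Finset.Icc 1 n, f ((t : ℤ) - m) ≤ ∑ t ∈ Finset.Icc 1 n, f t := by
  induction m with
  | zero => simp
  | succ m ih =>
    refine le_trans ?_ ih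
    rw [← sub_nonneg, ← Finset.sum_sub_distrib]
    have : ∀ n : ℕ, ∑ t ∈ Finset.Icc 1 n, (f ((t : ℤ) - m) - f ((t : ℤ) - (m + 1 : ℕ))) =
        f (n - m) := by
      intro n
      induction n with
      | zero => simp [hf0]
      | succ k ihk =>
        rw [Finset.sum_Icc_succ_top (by omega), ihk]
        push_cast
        rw [show (k : ℤ) + 1 - (m + 1) = k - m by ring]
        ring
    rw [this]
    exact hf _

lemma avg_shift_le {f : ℤ → ℝ} (hf : ∀ s, 0 ≤ f s) (hf0 : ∀ s ≤ 0, f s = 0) (n m : ℕ) :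
    avg n (fun t => f (t - m)) ≤ avg n f := by
  unfold avg
  exact mul_le_mul_of_nonneg_left (sum_shift_le hf hf0 n m) (by positivity)

lemma sum_range_abs_le {ψ : ℕ → ℝ} (hψ : Summable fun k => |ψ k|) (n : ℕ) :
    ∑ k ∈ Finset.range n, |ψ k| ≤ ∑' k, |ψ k| :=
  hψ.sum_le_tsum _ fun _ _ => abs_nonneg _

/-- Young's inequality in `ℓ⁴`. -/
lemma avg_conv_pow_four_le {ψ : ℕ → ℝ} (hψ : Summable fun k => |ψ k|) {f : ℤ → ℝ}
    (hf : ∀ s ≤ 0, f s = 0) (n m : ℕ) :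
    avg n (fun t => conv ψ f (t - m) ^ 4) ≤ (∑' k, |ψ k|) ^ 4 * avg n (fun t => f t ^ 4) := by
  set S := ∑' k, |ψ k|
  have hS : 0 ≤ S := tsum_nonneg fun _ => abs_nonneg _
  have hA : 0 ≤ avg n (fun t => f t ^ 4) := avg_nonneg fun _ => by positivity
  have h1 : avg n (fun t => conv ψ f (t - m) ^ 4) ≤
      avg n (fun t => S ^ 3 * ∑ k ∈ Finset.range n, |ψ k| * f (t - (m + k : ℕ)) ^ 4) := by
    refine avg_mono fun t _ htn => ?_
    refine (sum_mul_pow_four_le_abs _ _ _).trans ?_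
    gcongr
    · exact sum_range_abs_le hψ _
    -- Enlarging the range of k to one independent of t allows the sums over k and t to be
    -- exchanged.
    · refine (Finset.sum_le_sum_of_subset_of_nonneg (t := Finset.range n) ?_ ?_).trans
        (le_of_eq ?_)
      · intro k hk
        rw [Finset.mem_range] at *
        omega
      · intro k _ _
        positivity
      · refine Finset.sum_congr rfl fun k _ => ?_
        push_cast
        rw [sub_sub]
  refine h1.trans ?_
  rw [avg_const_mul, avg_sum]
  have h2 : ∑ k ∈ Finset.range n, avg n (fun t => |ψ k| * f (t - (m + k : ℕ)) ^ 4) ≤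
      S * avg n (fun t => f t ^ 4) := by
    refine le_trans (Finset.sum_le_sum fun k _ => ?_)
      ((Finset.sum_mul _ _ _).symm.trans_le
        (mul_le_mul_of_nonneg_right (sum_range_abs_le hψ n) hA))
    rw [avg_const_mul]
    gcongr
    exact avg_shift_le (f := fun s => f s ^ 4) (fun _ => by positivity)
      (fun s hs => by simp [hf s hs]) n (m + k)
  calc _ ≤ S ^ 3 * (S * avg n (fun t => f t ^ 4)) := by gcongr
    _ = _ := by ring

end ImpulseResponse

/-! ### Convergence in probability as convergence along a filter -/

section InProbability

variable {Ω : Type*} [MeasurableSpace Ω] {P : Measure Ω}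

/-- The filter of the sets of pairs `(n, ω)` whose sections have outer probability tending to
one. -/
def inProb (P : Measure Ω) : Filter (ℕ × Ω) where
  sets := {S | Tendsto (fun n => P {ω | (n, ω) ∉ S}) atTop (𝓝 0)}
  univ_sets := by simp
  sets_of_superset {S T} hS hST := by
    refine tendsto_of_tendsto_of_tendsto_of_le_of_le tendsto_const_nhds hS
      (fun n => zero_le) (fun n => measure_mono fun ω hω h => hω (hST h))
  inter_sets {S T} hS hT := by
    have h := Tendsto.add (show Tendsto _ _ _ from hS) (show Tendsto _ _ _ from hT)
    rw [add_zero] at h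
    refine tendsto_of_tendsto_of_tendsto_of_le_of_le tendsto_const_nhds h
      (fun n => zero_le) (fun n => (measure_mono ?_).trans (measure_union_le _ _))
    intro ω hω
    by_contra hc
    simp only [Set.mem_union, Set.mem_ofPred_eq, not_or, not_not] at hc
    exact hω hc

lemma eventually_inProb {p : ℕ × Ω → Prop} :
    (∀ᶠ q in inProb P, p q) ↔ Tendsto (fun n => P {ω | ¬ p (n, ω)}) atTop (𝓝 0) :=
  Iff.rfl

lemma tendsto_fst_inProb : Tendsto Prod.fst (inProb P) atTop := by
  refine tendsto_atTop.2 fun m => ?_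
  rw [eventually_inProb]
  refine tendsto_const_nhds.congr' ?_
  filter_upwards [eventually_ge_atTop m] with n hn
  simp [hn]

lemma eventually_inProb_of_atTop {p : ℕ → Prop} (h : ∀ᶠ n in atTop, p n) :
    ∀ᶠ q in inProb P, p q.1 :=
  tendsto_fst_inProb.eventually h

lemma tendsto_inProb_iff {Z : ℕ → Ω → ℝ} {c : ℝ} :
    Tendsto (fun q : ℕ × Ω => Z q.1 q.2) (inProb P) (𝓝 c) ↔
      ∀ η > 0, Tendsto (fun n => P {ω | η ≤ |Z n ω - c|}) atTop (𝓝 0) := by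
  rw [Metric.tendsto_nhds]
  simp only [eventually_inProb, Real.dist_eq, not_lt]

lemma tendstoInMeasure_of_tendsto_inProb {Z : ℕ → Ω → ℝ} {c : ℝ}
    (h : Tendsto (fun q : ℕ × Ω => Z q.1 q.2) (inProb P) (𝓝 c)) :
    TendstoInMeasure P Z atTop (fun _ => c) := by
  refine tendstoInMeasure_of_ne_top fun η hη hη' => ?_
  have h1 := tendsto_inProb_iff.1 h η.toReal (ENNReal.toReal_pos hη.ne' hη')
  refine h1.congr fun n => ?_
  congr 1
  ext ω
  rw [Set.mem_ofPred_eq, Set.mem_ofPred_eq, edist_dist, Real.dist_eq,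
    ENNReal.le_ofReal_iff_toReal_le hη' (abs_nonneg _)]

lemma tendsto_measure_one_of_eventually_inProb [IsProbabilityMeasure P] {p : ℕ × Ω → Prop}
    (h : ∀ᶠ q in inProb P, p q) : Tendsto (fun n => P {ω | p (n, ω)}) atTop (𝓝 1) := by
  rw [eventually_inProb] at h
  have h1 : Tendsto (fun n => 1 - P {ω | ¬ p (n, ω)}) atTop (𝓝 1) := by
    simpa using ENNReal.Tendsto.sub (tendsto_const_nhds (x := (1 : ENNReal))) h (by simp)
  refine tendsto_of_tendsto_of_tendsto_of_le_of_le h1 tendsto_const_nhds (fun n => ?_)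
    (fun n => prob_le_one)
  rw [tsub_le_iff_right, ← measure_univ (μ := P)]
  refine (measure_mono fun ω _ => ?_).trans (measure_union_le _ _)
  exact em (p (n, ω))

/-- The fourth power appears because starting values are discarded in fourth sample moments. -/
lemma tendsto_inv_mul_of_boundedInProbability {Z : ℕ → Ω → ℝ} (h : BoundedInProbability P Z) :
    Tendsto (fun q : ℕ × Ω => (q.1 : ℝ)⁻¹ * Z q.1 q.2 ^ 4) (inProb P) (𝓝 0) := by
  refine (tendsto_inProb_iff (Z := fun n ω => (n : ℝ)⁻¹ * Z n ω ^ 4)).2 fun η hη => ?_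
  rw [ENNReal.tendsto_nhds_zero]
  intro δ hδ
  obtain ⟨δ', hδ', hδδ'⟩ : ∃ δ' : ℝ, 0 < δ' ∧ ENNReal.ofReal δ' ≤ δ := by
    rcases eq_or_ne δ ⊤ with rfl | hδt
    · exact ⟨1, one_pos, le_top⟩
    · exact ⟨δ.toReal, ENNReal.toReal_pos hδ.ne' hδt, (ENNReal.ofReal_toReal hδt).le⟩
  obtain ⟨M, hM⟩ := h δ' hδ'
  have h1 : Tendsto (fun n : ℕ => (n : ℝ)⁻¹ * |M| ^ 4) atTop (𝓝 0) := by
    simpa using tendsto_inv_atTop_nhds_zero_nat.mul_const (|M| ^ 4)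
  filter_upwards [hM, h1.eventually_lt_const hη] with n hn hn1
  refine ((measure_mono fun ω hω => ?_).trans hn).trans hδδ'
  simp only [Set.mem_ofPred_eq, sub_zero] at hω ⊢
  by_contra! hc
  rw [abs_of_nonneg (by positivity)] at hω
  have h2 : Z n ω ^ 4 ≤ |M| ^ 4 := by
    rw [← Even.pow_abs (by decide : Even 4) (Z n ω)]
    exact pow_le_pow_left₀ (abs_nonneg _) (hc.trans (le_abs_self M)) 4
  have h3 : (n : ℝ)⁻¹ * Z n ω ^ 4 ≤ (n : ℝ)⁻¹ * |M| ^ 4 := by gcongr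
  linarith

/-- A weak law of large numbers for triangular arrays of uncorrelated variables. -/
lemma tendsto_inProb_avg_of_uncorrelated [IsProbabilityMeasure P] {D : ℕ → ℤ → Ω → ℝ} {C : ℝ}
    (hD : ∀ n t, MemLp (D n t) 2 P)
    (hcorr : ∀ n s t, s < t → ∫ ω, D n s ω * D n t ω ∂P = 0)
    (hC : ∀ n t, ∫ ω, D n t ω ^ 2 ∂P ≤ C) :
    Tendsto (fun q : ℕ × Ω => avg q.1 (fun t => D q.1 t q.2)) (inProb P) (𝓝 0) := by
  have hint : ∀ n s t, Integrable (fun ω => D n s ω * D n t ω) P := fun n s t =>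
    (hD n s).integrable_mul (hD n t)
  have hbound : ∀ n : ℕ, n ≠ 0 → ∫ ω, avg n (fun t => D n t ω) ^ 2 ∂P ≤ (n : ℝ)⁻¹ * C := by
    intro n hn
    have hn' : (n : ℝ) ≠ 0 := by exact_mod_cast hn
    have hexp : ∀ ω, avg n (fun t => D n t ω) ^ 2 = ((n : ℝ)⁻¹) ^ 2 *
        ∑ s ∈ Finset.Icc 1 n, ∑ t ∈ Finset.Icc 1 n, D n s ω * D n t ω := fun ω => by
      rw [avg, mul_pow, ← Finset.sum_mul_sum, sq (∑ t ∈ Finset.Icc 1 n, D n t ω)]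
    simp only [hexp]
    rw [integral_const_mul, integral_finsetSum _ fun (s : ℕ) _ =>
      integrable_finsetSum _ fun (t : ℕ) _ => hint n s t]
    have h1 : ∀ s ∈ Finset.Icc 1 n,
        ∫ ω, ∑ t ∈ Finset.Icc 1 n, D n s ω * D n t ω ∂P ≤ C := by
      intro s hs
      -- Uncorrelatedness leaves only the diagonal, so the double sum is at most nC rather than of
      -- order n².
      rw [integral_finsetSum _ fun (t : ℕ) _ => hint n s t, Finset.sum_eq_single_of_mem s hs]
      · simpa only [sq] using hC n s
      · intro t _ hts
        rcases lt_or_gt_of_ne hts with h | h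
        · simpa only [mul_comm] using hcorr n t s (by exact_mod_cast h)
        · exact hcorr n s t (by exact_mod_cast h)
    calc _ ≤ ((n : ℝ)⁻¹) ^ 2 * ∑ _s ∈ Finset.Icc 1 n, C := by
          gcongr with s hs
          exact h1 s hs
      _ = _ := by
          rw [Finset.sum_const, Nat.card_Icc, Nat.add_sub_cancel, nsmul_eq_mul]
          field_simp
  refine (tendsto_inProb_iff (Z := fun n ω => avg n (fun t => D n t ω))).2 fun η hη => ?_
  have hmem : ∀ n, MemLp (fun ω => avg n (fun t => D n t ω)) 2 P := fun n => by
    unfold avg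
    exact (memLp_finsetSum _ fun (t : ℕ) _ => hD n t).const_mul _
  have hlim : Tendsto (fun n : ℕ => ENNReal.ofReal ((n : ℝ)⁻¹ * C / η ^ 2)) atTop (𝓝 0) := by
    have : Tendsto (fun n : ℕ => (n : ℝ)⁻¹ * C / η ^ 2) atTop (𝓝 0) := by
      simpa using (tendsto_inv_atTop_nhds_zero_nat.mul_const C).div_const (η ^ 2)
    simpa using ENNReal.tendsto_ofReal this
  refine tendsto_of_tendsto_of_tendsto_of_le_of_le' tendsto_const_nhds hlim
    (Eventually.of_forall fun n => zero_le) ?_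
  filter_upwards [eventually_ne_atTop 0] with n hn
  have hmarkov := mul_meas_ge_le_integral_of_nonneg (μ := P)
    (f := fun ω => avg n (fun t => D n t ω) ^ 2)
    (Eventually.of_forall fun ω => sq_nonneg _) (hmem n).integrable_sq (η ^ 2)
  have hset : {ω | η ≤ |avg n (fun t => D n t ω) - 0|} =
      {ω | η ^ 2 ≤ avg n (fun t => D n t ω) ^ 2} := by
    ext ω
    rw [Set.mem_ofPred_eq, Set.mem_ofPred_eq, sub_zero, sq_le_sq, abs_of_pos hη]
  rw [hset]
  have hη2 : 0 < η ^ 2 := by positivity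
  rw [← ENNReal.ofReal_toReal (measure_ne_top P {ω | η ^ 2 ≤ avg n (fun t => D n t ω) ^ 2})]
  refine ENNReal.ofReal_le_ofReal ?_
  rw [le_div_iff₀ hη2, mul_comm]
  exact hmarkov.trans (hbound n hn)

end InProbability

/-! ### The volatility function -/

section Volatility

/-- The frontiers of the finitely many intervals are null, and g is Lipschitz near each interior
point. -/
lemma PiecewiseLipschitz.ae_continuousAt {g : ℝ → ℝ} (hg : PiecewiseLipschitz g) :
    ∀ᵐ r ∂(volume.restrict (Set.Ioc (0 : ℝ) 1)), ContinuousAt g r := by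
  obtain ⟨m, I, hI, -, hU, hL⟩ := hg
  rw [ae_restrict_iff' measurableSet_Ioc]
  have h0 : ∀ᵐ r : ℝ, ∀ j, r ∉ frontier (I j) := by
    rw [ae_all_iff]
    intro j
    exact measure_eq_zero_iff_ae_notMem.1 ((hI j).convex.addHaar_frontier volume)
  filter_upwards [h0] with r hr hr01
  rw [← hU, Set.mem_iUnion] at hr01
  obtain ⟨j, hj⟩ := hr01
  obtain ⟨K, hK⟩ := hL j
  have hint : r ∈ interior (I j) := by
    by_contra hc
    exact hr j ⟨subset_closure hj, hc⟩
  exact hK.continuousOn.continuousAt (mem_interior_iff_mem_nhds.1 hint)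

lemma tendsto_ceil_mul_div {r : ℝ} (hr : 0 ≤ r) :
    Tendsto (fun n : ℕ => ((⌈(n : ℝ) * r⌉₊ : ℕ) : ℝ) / n) atTop (𝓝 r) := by
  have h := (tendsto_nat_ceil_mul_div_atTop hr).comp (tendsto_natCast_atTop_atTop (R := ℝ))
  refine h.congr fun n => ?_
  simp only [Function.comp_apply, mul_comm r]

lemma ceil_mul_mem {n : ℕ} (hn : n ≠ 0) {r : ℝ} (hr : r ∈ Set.Ioc (0 : ℝ) 1) :
    1 ≤ ⌈(n : ℝ) * r⌉₊ ∧ ⌈(n : ℝ) * r⌉₊ ≤ n := by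
  have hn' : (0 : ℝ) < n := by exact_mod_cast Nat.pos_of_ne_zero hn
  refine ⟨Nat.one_le_ceil_iff.2 (mul_pos hn' hr.1), Nat.ceil_le.2 ?_⟩
  nlinarith [hr.2]

lemma natCast_div_mem_Ioc {n t : ℕ} (h1 : 1 ≤ t) (h2 : t ≤ n) :
    (t : ℝ) / n ∈ Set.Ioc (0 : ℝ) 1 := by
  have h1' : (0 : ℝ) < t := by exact_mod_cast h1
  have h2' : (t : ℝ) ≤ n := by exact_mod_cast h2
  exact ⟨div_pos h1' (h1'.trans_le h2'), div_le_one_of_le₀ h2' (h1'.le.trans h2')⟩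

/-- The right Riemann sum is the integral of a step function. -/
lemma avg_eq_integral_ceil {n : ℕ} (hn : n ≠ 0) (h : ℝ → ℝ) :
    avg n (fun t => h ((t : ℝ) / n)) =
      ∫ r in Set.Ioc (0 : ℝ) 1, h ((⌈(n : ℝ) * r⌉₊ : ℝ) / n) := by
  have hn' : (0 : ℝ) < n := by exact_mod_cast Nat.pos_of_ne_zero hn
  have hconst : ∀ k : ℕ, Set.EqOn (fun r => h ((⌈(n : ℝ) * r⌉₊ : ℝ) / n))
      (fun _ => h (((k + 1 : ℕ) : ℝ) / n))
      (Set.uIoc ((k : ℝ) / n) (((k + 1 : ℕ) : ℝ) / n)) := by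
    intro k r hr
    rw [Set.uIoc_of_le (by gcongr; simp)] at hr
    have : ⌈(n : ℝ) * r⌉₊ = k + 1 := by
      rw [Nat.ceil_eq_iff (by simp)]
      have h1 := (div_lt_iff₀ hn').1 hr.1
      have h2 := (le_div_iff₀ hn').1 hr.2
      rw [mul_comm] at h1 h2
      exact ⟨by simpa using h1, h2⟩
    simp only [this]
  have hint : ∀ k < n, IntervalIntegrable (fun r => h ((⌈(n : ℝ) * r⌉₊ : ℝ) / n)) volume
      ((k : ℝ) / n) (((k + 1 : ℕ) : ℝ) / n) := fun k _ =>
    (intervalIntegrable_const (c := h (((k + 1 : ℕ) : ℝ) / n))).congr (hconst k).symm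
  have hsum := intervalIntegral.sum_integral_adjacent_intervals
    (a := fun k : ℕ => (k : ℝ) / n) hint
  simp only [Nat.cast_zero, zero_div, div_self hn'.ne'] at hsum
  rw [← intervalIntegral.integral_of_le zero_le_one, ← hsum, avg, Finset.mul_sum,
    ← Finset.Ico_add_one_right_eq_Icc, Finset.sum_Ico_eq_sum_range, Nat.add_sub_cancel]
  refine Finset.sum_congr rfl fun k _ => ?_
  rw [intervalIntegral.integral_congr_ae (Eventually.of_forall fun r hr => hconst k hr), intervalIntegral.integral_const,
    smul_eq_mul, add_comm 1 k, Int.cast_natCast, ← sub_div]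
  push_cast
  rw [add_sub_cancel_left, one_div]

/-- Dominated convergence for the step functions r ↦ h(⌈nr⌉/n), which converge at every continuity
point of h. -/
lemma tendsto_avg_integral {h : ℝ → ℝ} {M : ℝ} (hM : ∀ r ∈ Set.Ioc (0 : ℝ) 1, |h r| ≤ M)
    (hc : ∀ᵐ r ∂(volume.restrict (Set.Ioc (0 : ℝ) 1)), ContinuousAt h r) :
    Tendsto (fun n : ℕ => avg n (fun t => h ((t : ℝ) / n))) atTop
      (𝓝 (∫ r in (0 : ℝ)..1, h r)) := by
  rw [intervalIntegral.integral_of_le zero_le_one]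
  -- At n = 0 the step function would evaluate h at 0, outside the interval where h is bounded;
  -- hence the guard.
  have hlim : Tendsto (fun n : ℕ => ∫ r in Set.Ioc (0 : ℝ) 1,
      (if n = 0 then 0 else h ((⌈(n : ℝ) * r⌉₊ : ℝ) / n))) atTop
      (𝓝 (∫ r in Set.Ioc (0 : ℝ) 1, h r)) := by
    refine tendsto_integral_of_dominated_convergence (fun _ => M) (fun n => ?_)
      (integrable_const _) (fun n => ?_) ?_
    · by_cases hn : n = 0
      · simp [hn, aestronglyMeasurable_const]
      · simp only [hn, if_false]
        refine Measurable.aestronglyMeasurable ?_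
        have h1 : Measurable fun k : ℕ => h ((k : ℝ) / n) := measurable_from_top
        exact h1.comp (Nat.measurable_ceil.comp (measurable_const_mul _))
    · rw [ae_restrict_iff' measurableSet_Ioc]
      refine Eventually.of_forall fun r hr => ?_
      by_cases hn : n = 0
      · simpa [hn] using (abs_nonneg _).trans (hM r hr)
      · simp only [hn, if_false, Real.norm_eq_abs]
        obtain ⟨h1, h2⟩ := ceil_mul_mem hn hr
        exact hM _ (natCast_div_mem_Ioc h1 h2)
    · rw [ae_restrict_iff' measurableSet_Ioc] at hc ⊢
      filter_upwards [hc] with r hr hr01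
      refine ((hr hr01).tendsto.comp (tendsto_ceil_mul_div hr01.1.le)).congr' ?_
      filter_upwards [eventually_ne_atTop 0] with n hn
      simp [hn]
  refine hlim.congr' ?_
  filter_upwards [eventually_ne_atTop 0] with n hn
  simp only [hn, if_false]
  exact (avg_eq_integral_ceil hn h).symm

variable {g : ℝ → ℝ}

/-- The lower bound is assumed only at grid points t/n. It passes to each continuity point r as the
limit of ⌈nr⌉/n. -/
lemma AssumptionA1i.ae_lower (hg : AssumptionA1i g) :
    ∃ c : ℝ, 0 < c ∧ ∀ᵐ r ∂(volume.restrict (Set.Ioc (0 : ℝ) 1)), c ≤ g r := by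
  obtain ⟨c, hc, hcg⟩ := hg.lower
  refine ⟨c, hc, ?_⟩
  have h := hg.lipschitz.ae_continuousAt
  rw [ae_restrict_iff' measurableSet_Ioc] at h ⊢
  filter_upwards [h] with r hr hr01
  refine ge_of_tendsto ((hr hr01).tendsto.comp (tendsto_ceil_mul_div hr01.1.le)) ?_
  filter_upwards [eventually_ne_atTop 0] with n hn
  obtain ⟨h1, h2⟩ := ceil_mul_mem hn hr01
  exact hcg n _ h1 h2

lemma AssumptionA1i.aemeasurable (hg : AssumptionA1i g) :
    AEMeasurable g (volume.restrict (Set.Ioc (0 : ℝ) 1)) :=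
  (aemeasurable_restrict_iff_comap_subtype measurableSet_Ioc).2 hg.measurable.aemeasurable

lemma AssumptionA1i.integrable_pow (hg : AssumptionA1i g) (j : ℕ) :
    Integrable (fun r => g r ^ j) (volume.restrict (Set.Ioc (0 : ℝ) 1)) := by
  obtain ⟨M, hM⟩ := hg.bounded
  refine Integrable.of_bound (hg.aemeasurable.pow_const j).aestronglyMeasurable (M ^ j) ?_
  rw [ae_restrict_iff' measurableSet_Ioc]
  refine Eventually.of_forall fun r hr => ?_
  rw [norm_pow, Real.norm_eq_abs]
  exact pow_le_pow_left₀ (abs_nonneg _) (hM r hr) j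

lemma AssumptionA1i.tendsto_avg_pow (hg : AssumptionA1i g) (j : ℕ) :
    Tendsto (fun n : ℕ => avg n (fun t => g ((t : ℝ) / n) ^ j)) atTop
      (𝓝 (∫ r in (0 : ℝ)..1, g r ^ j)) := by
  obtain ⟨M, hM⟩ := hg.bounded
  refine tendsto_avg_integral (h := fun r => g r ^ j) (M := M ^ j) (fun r hr => ?_) ?_
  · rw [abs_pow]
    exact pow_le_pow_left₀ (abs_nonneg _) (hM r hr) j
  · filter_upwards [hg.lipschitz.ae_continuousAt] with r hr
    exact hr.pow j

lemma AssumptionA1i.integral_sq_pos (hg : AssumptionA1i g) :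
    0 < ∫ r in (0 : ℝ)..1, g r ^ 2 := by
  obtain ⟨c, hc, hcg⟩ := hg.ae_lower
  rw [intervalIntegral.integral_of_le zero_le_one]
  have h : ∫ _r in Set.Ioc (0 : ℝ) 1, c ^ 2 ≤ ∫ r in Set.Ioc (0 : ℝ) 1, g r ^ 2 := by
    refine integral_mono_ae (integrable_const _) (hg.integrable_pow 2) ?_
    filter_upwards [hcg] with r hr
    gcongr
  have : 0 < c ^ 2 := by positivity
  refine lt_of_lt_of_le this ?_
  simpa using h

/-- Strict Cauchy-Schwarz inequality for a non-constant volatility. -/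
lemma one_lt_kappa2 (hg : AssumptionA1i g)
    (hne : ¬ ∃ k : ℝ, ∀ᵐ r ∂(volume.restrict (Set.Ioc (0 : ℝ) 1)), g r = k) :
    1 < kappa2 g := by
  have hpos := hg.integral_sq_pos
  rw [kappa2, one_lt_div (by positivity)]
  simp only [intervalIntegral.integral_of_le (zero_le_one (α := ℝ))] at *
  set s := ∫ r in Set.Ioc (0 : ℝ) 1, g r ^ 2 with hs
  have h2 := hg.integrable_pow 2
  have h4 := hg.integrable_pow 4
  have hexp : ∀ r, (g r ^ 2 - s) ^ 2 = (g r ^ 4 - 2 * s * g r ^ 2) + s ^ 2 := fun r => by ring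
  have hint : Integrable (fun r => (g r ^ 2 - s) ^ 2) (volume.restrict (Set.Ioc (0 : ℝ) 1)) := by
    simp only [hexp]
    exact (h4.sub (h2.const_mul _)).add (integrable_const _)
  have hval : ∫ r in Set.Ioc (0 : ℝ) 1, (g r ^ 2 - s) ^ 2 =
      (∫ r in Set.Ioc (0 : ℝ) 1, g r ^ 4) - s ^ 2 := by
    simp only [hexp]
    have h24 : Integrable (fun r => g r ^ 4 - 2 * s * g r ^ 2)
        (volume.restrict (Set.Ioc (0 : ℝ) 1)) := h4.sub (h2.const_mul _)
    rw [integral_add h24 (integrable_const _),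
      integral_sub h4 (h2.const_mul _), integral_const_mul, ← hs]
    simp
    ring
  have hnn : 0 ≤ ∫ r in Set.Ioc (0 : ℝ) 1, (g r ^ 2 - s) ^ 2 :=
    integral_nonneg fun _ => sq_nonneg _
  -- Equality means zero variance of g², so g² = s almost everywhere. Positivity of g excludes a
  -- change of sign and gives g = √s.
  refine lt_of_le_of_ne (by linarith) fun heq => hne ⟨√s, ?_⟩
  have hz : ∫ r in Set.Ioc (0 : ℝ) 1, (g r ^ 2 - s) ^ 2 = 0 := by rw [hval, ← heq, sub_self]
  rw [integral_eq_zero_iff_of_nonneg (fun _ => sq_nonneg _) hint] at hz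
  obtain ⟨c, hc, hcg⟩ := hg.ae_lower
  filter_upwards [hz, hcg] with r hr hr'
  have h1 : g r ^ 2 = s := by
    have : (g r ^ 2 - s) ^ 2 = 0 := hr
    linarith [pow_eq_zero_iff (two_ne_zero) |>.1 this]
  rw [← h1, Real.sqrt_sq (hc.le.trans hr')]

end Volatility

/-! ### Laws of large numbers for the errors -/

section Errors

section ErrorSequence

variable {Ω : Type*}

/-- The errors `u_t = g(t/n) ε_t` at the sample times, extended by zero. -/
def err (g : ℝ → ℝ) (ε : ℕ → Ω → ℝ) (n : ℕ) (t : ℤ) (ω : Ω) : ℝ :=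
  if 1 ≤ t ∧ t ≤ n then g ((t : ℝ) / n) * ε t.toNat ω else 0

lemma err_of_mem (g : ℝ → ℝ) (ε : ℕ → Ω → ℝ) {n t : ℕ} (h1 : 1 ≤ t) (h2 : t ≤ n) (ω : Ω) :
    err g ε n t ω = g ((t : ℝ) / n) * ε t ω := by
  rw [err, if_pos ⟨by exact_mod_cast h1, by exact_mod_cast h2⟩]
  simp

lemma err_of_nonpos (g : ℝ → ℝ) (ε : ℕ → Ω → ℝ) (n : ℕ) {t : ℤ} (h : t ≤ 0) (ω : Ω) :
    err g ε n t ω = 0 := by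
  rw [err, if_neg (by omega)]

/-- The deterministic scale of the errors, extended by zero. -/
def scale (g : ℝ → ℝ) (n : ℕ) (t : ℤ) : ℝ := if 1 ≤ t ∧ t ≤ n then g ((t : ℝ) / n) else 0

lemma err_eq_scale_mul (g : ℝ → ℝ) (ε : ℕ → Ω → ℝ) (n : ℕ) (t : ℤ) (ω : Ω) :
    err g ε n t ω = scale g n t * ε t.toNat ω := by
  rw [err, scale]
  split_ifs <;> simp

end ErrorSequence

variable {Ω : Type*} [MeasurableSpace Ω] {P : Measure Ω} {ε : ℕ → Ω → ℝ}

lemma AssumptionA1ii.memLp [IsProbabilityMeasure P] (hε : AssumptionA1ii P ε) (t : ℕ) :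
    MemLp (ε t) 8 P := by
  obtain ⟨ν, hν, h⟩ := hε.moment
  have h1 : MemLp (ε t) (ENNReal.ofReal (8 * ν)) P := by
    have hne : ENNReal.ofReal (8 * ν) ≠ 0 := by
      rw [Ne, ENNReal.ofReal_eq_zero]
      linarith
    refine (integrable_norm_rpow_iff (hε.measurable t).aestronglyMeasurable hne
      ENNReal.ofReal_ne_top).1 ?_
    rw [ENNReal.toReal_ofReal (by linarith)]
    simpa only [Real.norm_eq_abs] using h t
  refine h1.mono_exponent ?_
  rw [show (8 : ENNReal) = ENNReal.ofReal 8 by simp]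
  exact ENNReal.ofReal_le_ofReal (by linarith)

/-- Eighth moments make ε⁴ square integrable, as the L² law of large numbers for fourth sample
moments requires. -/
lemma AssumptionA1ii.memLp_pow [IsProbabilityMeasure P] (hε : AssumptionA1ii P ε) (t : ℕ)
    {j : ℕ} (hj : j ≤ 4) : MemLp (fun ω => ε t ω ^ j) 2 P := by
  rw [memLp_two_iff_integrable_sq ((hε.measurable t).pow_const j).aestronglyMeasurable]
  simp only [← pow_mul]
  have h : MemLp (ε t) ((j * 2 : ℕ) : ENNReal) P := (hε.memLp t).mono_exponent (by
    have : ((j * 2 : ℕ) : ENNReal) ≤ ((8 : ℕ) : ENNReal) := by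
      exact_mod_cast (by omega : j * 2 ≤ 8)
    simpa using this)
  refine (integrable_norm_iff ((hε.measurable t).pow_const _).aestronglyMeasurable).1 ?_
  simpa only [norm_pow] using h.integrable_norm_pow'

lemma AssumptionA1ii.integral_pow (hε : AssumptionA1ii P ε) (t j : ℕ) :
    ∫ ω, ε t ω ^ j ∂P = ∫ ω, ε 1 ω ^ j ∂P :=
  ((hε.ident t 1).comp (measurable_id.pow_const j)).integral_eq

/-- A product of three innovations is uncorrelated with any later innovation. -/
lemma AssumptionA1ii.integral_mul_eq_zero [IsProbabilityMeasure P] (hε : AssumptionA1ii P ε)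
    {a b c N : ℕ} (ha : a < N) (hb : b < N) (hc : c < N) :
    ∫ ω, ε a ω * ε b ω * ε c ω * ε N ω ∂P = 0 := by
  have hind := hε.indep.indepFun_finset (Finset.range N) {N} (by simp) hε.measurable
  have h1 : Measurable fun f : Finset.range N → ℝ => f ⟨a, by simpa using ha⟩ *
      f ⟨b, by simpa using hb⟩ * f ⟨c, by simpa using hc⟩ := by fun_prop
  have h2 : Measurable fun f : ({N} : Finset ℕ) → ℝ => f ⟨N, by simp⟩ := measurable_pi_apply _
  have hind' := hind.comp h1 h2
  have h := hind'.integral_fun_mul_eq_mul_integral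
    (((hε.measurable a).mul (hε.measurable b)).mul (hε.measurable c)).aestronglyMeasurable
    (hε.measurable N).aestronglyMeasurable
  refine h.trans ?_
  have : ∫ ω, ε N ω ∂P = 0 := hε.mean N
  exact mul_eq_zero_of_right _ this

variable {g : ℝ → ℝ}

lemma AssumptionA1i.exists_abs_scale_le (hg : AssumptionA1i g) :
    ∃ M : ℝ, 0 ≤ M ∧ ∀ n t, |scale g n t| ≤ M := by
  obtain ⟨M, hM⟩ := hg.bounded
  have hM0 : 0 ≤ M := (abs_nonneg _).trans (hM 1 (by simp))
  refine ⟨M, hM0, fun n t => ?_⟩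
  rw [scale]
  split_ifs with h
  · lift t to ℕ using by omega
    simpa using hM _ (natCast_div_mem_Ioc (by exact_mod_cast h.1) (by exact_mod_cast h.2))
  · simpa using hM0

/-- With m = E ε^j, split u^j = g^j (ε^j - m) + m g^j: the first part is uncorrelated with bounded
variance, the second is a Riemann sum. -/
lemma tendsto_avg_err_pow [IsProbabilityMeasure P] (hg : AssumptionA1i g)
    (hε : AssumptionA1ii P ε) {j : ℕ} (hj1 : 1 ≤ j) (hj : j ≤ 4) :
    Tendsto (fun q : ℕ × Ω => avg q.1 (fun t => err g ε q.1 t q.2 ^ j)) (inProb P)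
      (𝓝 ((∫ r in (0 : ℝ)..1, g r ^ j) * ∫ ω, ε 1 ω ^ j ∂P)) := by
  set m := ∫ ω, ε 1 ω ^ j ∂P with hm
  obtain ⟨M, hM0, hM⟩ := hg.exists_abs_scale_le
  let E : ℕ → Ω → ℝ := fun t ω => ε t ω ^ j - m
  have hE : ∀ t, MemLp (E t) 2 P := fun t => (hε.memLp_pow t hj).sub (memLp_const m)
  have hE0 : ∀ t, ∫ ω, E t ω ∂P = 0 := fun t => by
    have h1 : Integrable (fun ω => ε t ω ^ j) P := (hε.memLp_pow t hj).integrable (by norm_num)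
    rw [integral_sub h1 (integrable_const _), hε.integral_pow t j]
    simp [hm]
  have hEE : ∀ s t, s ≠ t → ∫ ω, E s ω * E t ω ∂P = 0 := fun s t hst => by
    have hind := (hε.indep.indepFun hst).comp (φ := fun x : ℝ => x ^ j - m)
      (ψ := fun x : ℝ => x ^ j - m) (by fun_prop) (by fun_prop)
    refine (hind.integral_fun_mul_eq_mul_integral (hE s).1 (hE t).1).trans ?_
    exact mul_eq_zero_of_left (hE0 s) _
  have hE2 : ∀ t, ∫ ω, E t ω ^ 2 ∂P = ∫ ω, E 1 ω ^ 2 ∂P := fun t =>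
    ((hε.ident t 1).comp (u := fun x : ℝ => (x ^ j - m) ^ 2) (by fun_prop)).integral_eq
  have hlln := tendsto_inProb_avg_of_uncorrelated (P := P)
    (D := fun n t ω => scale g n t ^ j * E t.toNat ω) (C := (M ^ j) ^ 2 * ∫ ω, E 1 ω ^ 2 ∂P)
    (fun n t => (hE _).const_mul _) (fun n s t hst => ?_) (fun n t => ?_)
  · have hdet := (hg.tendsto_avg_pow j).comp (tendsto_fst_inProb (P := P))
    have := hlln.add (hdet.mul_const m)
    rw [zero_add] at this
    refine this.congr fun q => ?_
    simp only [Function.comp_apply]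
    rw [mul_comm (avg _ _) m, ← avg_const_mul, ← avg_add]
    refine avg_congr fun t h1 h2 => ?_
    rw [err_eq_scale_mul, mul_pow, scale, if_pos ⟨by exact_mod_cast h1, by exact_mod_cast h2⟩]
    simp only [E]
    ring
  · rcases le_or_gt s 0 with hs | hs
    -- `Int.toNat` sends all nonpositive times to the same innovation, so independence fails there;
    -- the zero scale, with j ≥ 1, removes these terms.
    · have : scale g n s = 0 := by rw [scale, if_neg (by omega)]
      have h0 : (0 : ℝ) ^ j = 0 := zero_pow (by omega)
      simp [this, h0]
    · have hne : s.toNat ≠ t.toNat := by omega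
      have : ∀ ω, scale g n s ^ j * E s.toNat ω * (scale g n t ^ j * E t.toNat ω) =
          (scale g n s ^ j * scale g n t ^ j) * (E s.toNat ω * E t.toNat ω) := fun ω => by ring
      simp only [this]
      rw [integral_const_mul, hEE _ _ hne, mul_zero]
  · simp only [mul_pow _ _ 2]
    rw [integral_const_mul, hE2]
    have : 0 ≤ ∫ ω, E 1 ω ^ 2 ∂P := integral_nonneg fun _ => sq_nonneg _
    gcongr ?_ * _
    rw [← sq_abs]
    gcongr
    rw [abs_pow]
    exact pow_le_pow_left₀ (abs_nonneg _) (hM n t) j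

/-- For s < t and i < l, the factor ε_{t-i} is strictly later than the other three in the product of
the terms at s and t, so these terms are uncorrelated. -/
lemma tendsto_avg_err_mul_of_lt [IsProbabilityMeasure P] (hg : AssumptionA1i g)
    (hε : AssumptionA1ii P ε) {i l : ℕ} (hil : i < l) :
    Tendsto (fun q : ℕ × Ω => avg q.1 (fun t => err g ε q.1 (t - i) q.2 *
      err g ε q.1 (t - l) q.2)) (inProb P) (𝓝 0) := by
  obtain ⟨M, hM0, hM⟩ := hg.exists_abs_scale_le
  have hmeas : ∀ t, Measurable (ε t) := hε.measurable
  have h4 : ∀ t, Integrable (fun ω => ε t ω ^ 4) P := fun t =>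
    (hε.memLp_pow t le_rfl).integrable (by norm_num)
  have hle : ∀ x y : ℝ, (x * y) ^ 2 ≤ x ^ 4 + y ^ 4 := fun x y => by
    nlinarith [sq_nonneg (x ^ 2 - y ^ 2), sq_nonneg (x ^ 2), sq_nonneg (y ^ 2)]
  have hprodint : ∀ s t, Integrable (fun ω => (ε s ω * ε t ω) ^ 2) P := fun s t =>
    ((h4 s).add (h4 t)).mono' (((hmeas s).mul (hmeas t)).pow_const 2).aestronglyMeasurable
      (Eventually.of_forall fun ω => by
        rw [Real.norm_eq_abs, abs_of_nonneg (sq_nonneg _)]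
        exact hle _ _)
  have hprod : ∀ s t, MemLp (fun ω => ε s ω * ε t ω) 2 P := fun s t =>
    (memLp_two_iff_integrable_sq ((hmeas s).mul (hmeas t)).aestronglyMeasurable).2 (hprodint s t)
  have hexp : ∀ n t ω, err g ε n (t - i) ω * err g ε n (t - l) ω =
      (scale g n (t - i) * scale g n (t - l)) *
        (ε (t - i).toNat ω * ε (t - l).toNat ω) := fun n t ω => by
    rw [err_eq_scale_mul, err_eq_scale_mul]
    ring
  simp only [hexp]
  refine tendsto_inProb_avg_of_uncorrelated (P := P)
    (D := fun n t ω => (scale g n (t - i) * scale g n (t - l)) *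
        (ε (t - i).toNat ω * ε (t - l).toNat ω))
    (C := (M * M) ^ 2 * ((∫ ω, ε 1 ω ^ 4 ∂P) + ∫ ω, ε 1 ω ^ 4 ∂P))
    (fun n t => (hprod _ _).const_mul _) (fun n s t hst => ?_) (fun n t => ?_)
  · rcases le_or_gt (s - l) 0 with hs | hs
    · have : scale g n (s - l) = 0 := by rw [scale, if_neg (by omega)]
      simp [this]
    · have hexp2 : ∀ ω, (scale g n (s - i) * scale g n (s - l)) *
          (ε (s - i).toNat ω * ε (s - l).toNat ω) * ((scale g n (t - i) * scale g n (t - l)) *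
          (ε (t - i).toNat ω * ε (t - l).toNat ω)) =
          (scale g n (s - i) * scale g n (s - l) * (scale g n (t - i) * scale g n (t - l))) *
          (ε (s - i).toNat ω * ε (s - l).toNat ω * ε (t - l).toNat ω * ε (t - i).toNat ω) :=
        fun ω => by ring
      simp only [hexp2]
      rw [integral_const_mul, hε.integral_mul_eq_zero (by omega) (by omega) (by omega), mul_zero]
  · simp only [mul_pow _ (_ * _) 2]
    rw [integral_const_mul]
    have h1 : ∫ ω, (ε (t - i).toNat ω * ε (t - l).toNat ω) ^ 2 ∂P ≤
        (∫ ω, ε 1 ω ^ 4 ∂P) + ∫ ω, ε 1 ω ^ 4 ∂P := by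
      refine le_trans (b := (∫ ω, ε (t - i).toNat ω ^ 4 ∂P) + ∫ ω, ε (t - l).toNat ω ^ 4 ∂P)
        ?_ (le_of_eq ?_)
      swap
      · rw [hε.integral_pow (t - i).toNat 4, hε.integral_pow (t - l).toNat 4]
      rw [← integral_add (h4 _) (h4 _)]
      exact integral_mono (hprodint _ _) ((h4 _).add (h4 _)) fun ω => hle _ _
    have h0 : 0 ≤ ∫ ω, (ε (t - i).toNat ω * ε (t - l).toNat ω) ^ 2 ∂P :=
      integral_nonneg fun _ => sq_nonneg _
    refine mul_le_mul ?_ h1 h0 (by positivity)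
    rw [← sq_abs, abs_mul]
    gcongr
    · exact hM _ _
    · exact hM _ _

end Errors

/-! ### Sample second moments of a stable autoregression -/

section Autoregression

variable {Q : Type*} {L : Filter Q} {N : Q → ℕ} {p : ℕ} {a : Fin p → ℝ} {x U : Q → ℤ → ℝ}
  {σ₂ α₄ : ℝ}

/-- Autoregressive sequences `x q` on `1 - p ≤ t ≤ N q` with negligible starting values, whose
errors `U q` have convergent sample moments and vanishing sample autocovariances along `L`. -/
structure IsAsymptoticAR (L : Filter Q) (N : Q → ℕ) (a : Fin p → ℝ) (x U : Q → ℤ → ℝ)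
    (σ₂ α₄ : ℝ) : Prop where
  size : Tendsto N L atTop
  recursion : ∀ q, ∀ t : ℕ, 1 ≤ t → t ≤ N q →
    x q t = ∑ i : Fin p, a i * x q ((t : ℤ) - ((i : ℕ) + 1 : ℤ)) + U q t
  start : ∀ j : Fin p, Tendsto (fun q => (N q : ℝ)⁻¹ * x q (-((j : ℕ) : ℤ)) ^ 4) L (𝓝 0)
  err_nonpos : ∀ q, ∀ s ≤ 0, U q s = 0
  mean : Tendsto (fun q => avg (N q) (U q)) L (𝓝 0)
  second : Tendsto (fun q => avg (N q) (fun t => U q t ^ 2)) L (𝓝 σ₂)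
  fourth : Tendsto (fun q => avg (N q) (fun t => U q t ^ 4)) L (𝓝 α₄)
  autocov : ∀ i l : ℕ, i < l →
    Tendsto (fun q => avg (N q) (fun t => U q (t - i) * U q (t - l))) L (𝓝 0)

namespace IsAsymptoticAR

/-- The starting values do not contribute to fourth sample moments. -/
lemma tendsto_avg_start (h : IsAsymptoticAR L N a x U σ₂ α₄) {m : ℕ} (hm : m ≤ p) :
    Tendsto (fun q => avg (N q) (fun t => (if t - m ≤ 0 then x q (t - m) else 0) ^ 4)) L
      (𝓝 0) := by
  have hlim : Tendsto (fun q => ∑ t ∈ Finset.Icc 1 m, (N q : ℝ)⁻¹ * x q ((t : ℤ) - m) ^ 4) L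
      (𝓝 0) := by
    rw [← Finset.sum_const_zero (s := Finset.Icc 1 m)]
    refine tendsto_finsetSum _ fun t ht => ?_
    rw [Finset.mem_Icc] at ht
    have h1 := h.start ⟨m - t, by omega⟩
    have h2 : -((m - t : ℕ) : ℤ) = (t : ℤ) - m := by omega
    simpa only [h2] using h1
  refine squeeze_zero (fun q => avg_nonneg fun t => by positivity) (fun q => ?_) hlim
  set F : ℕ → ℝ := fun t => (if (t : ℤ) - m ≤ 0 then x q ((t : ℤ) - m) else 0) ^ 4
  have hF : ∀ t, 0 ≤ F t := fun t => by positivity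
  have h1 : ∑ t ∈ Finset.Icc 1 (N q), F t ≤ ∑ t ∈ Finset.Icc 1 m, x q ((t : ℤ) - m) ^ 4 := by
    calc _ ≤ ∑ t ∈ Finset.Icc 1 (N q) ∪ Finset.Icc 1 m, F t :=
          Finset.sum_le_sum_of_subset_of_nonneg Finset.subset_union_left fun t _ _ => hF t
      _ = ∑ t ∈ Finset.Icc 1 m, F t := by
          refine (Finset.sum_subset Finset.subset_union_right fun t ht ht' => ?_).symm
          simp only [Finset.mem_union, Finset.mem_Icc] at ht ht'
          simp only [F]
          rw [if_neg (by omega)]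
          norm_num
      _ = _ := by
          refine Finset.sum_congr rfl fun t ht => ?_
          rw [Finset.mem_Icc] at ht
          simp only [F]
          rw [if_pos (by omega)]
  rw [← Finset.mul_sum]
  exact mul_le_mul_of_nonneg_left h1 (by positivity)

/-- The contribution of the starting values to the recursion at positive times. -/
def startErr (a : Fin p → ℝ) (x : ℤ → ℝ) (s : ℤ) : ℝ :=
  if s ≤ 0 then 0 else ∑ i : Fin p, a i *
    if s - ((i : ℕ) + 1 : ℕ) ≤ 0 then x (s - ((i : ℕ) + 1 : ℕ)) else 0

lemma tendsto_avg_startErr (h : IsAsymptoticAR L N a x U σ₂ α₄) :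
    Tendsto (fun q => avg (N q) (fun t => startErr a (x q) t ^ 4)) L (𝓝 0) := by
  have h1 := tendsto_avg_sum_pow_four_zero (L := L) (N := N) (Finset.univ : Finset (Fin p))
    (f := fun i q t => a i * if t - ((i : ℕ) + 1 : ℕ) ≤ 0 then x q (t - ((i : ℕ) + 1 : ℕ)) else 0)
    (fun i _ => by
      have h2 := (h.tendsto_avg_start (m := (i : ℕ) + 1) (by omega)).const_mul (a i ^ 4)
      rw [mul_zero] at h2
      simpa only [mul_pow, avg_const_mul] using h2)
  refine h1.congr fun q => avg_congr fun t ht _ => ?_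
  rw [startErr, if_neg (by omega)]

variable {ψ : PowerSeries ℝ}

/-- The moving average representation up to the effect of the starting values. -/
lemma sub_conv_eq (h : IsAsymptoticAR L N a x U σ₂ α₄) (hψ : lagSeries a * ψ = 1) (q : Q)
    {s : ℤ} (hs : s ≤ N q) :
    x q s - conv (fun k => PowerSeries.coeff k ψ) (U q) s =
      (if s ≤ 0 then x q s else 0) +
        conv (fun k => PowerSeries.coeff k ψ) (startErr a (x q)) s := by
  -- Cutting x off at nonpositive times makes the inversion formula exact, with `startErr` added to
  -- the errors.
  let X : ℤ → ℝ := fun t => if t ≤ 0 then 0 else x q t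
  have hX := eq_conv_of_lagSeries_mul_eq_one hψ (x := X) (fun t ht => if_pos ht) s
  rw [conv_congr (g := fun t => U q t + startErr a (x q) t) _ (fun t ht1 hts => ?_),
    conv_add] at hX
  · have : x q s = (if s ≤ 0 then x q s else 0) + X s := by
      simp only [X]
      split_ifs <;> ring
    linarith
  · have h1 := h.recursion q t.toNat (by omega) (by omega)
    rw [Int.toNat_of_nonneg (by omega)] at h1
    simp only [X, startErr]
    rw [if_neg (by omega), if_neg (by omega), h1, add_sub_assoc, add_comm, sub_add_eq_add_sub,
      sub_eq_iff_eq_add, add_assoc, ← Finset.sum_add_distrib]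
    congr 1
    refine Finset.sum_congr rfl fun i _ => ?_
    push_cast
    split_ifs <;> ring

/-- Starting values affect finitely many terms of the recursion, and Young's inequality bounds their
propagation through ψ. -/
lemma tendsto_avg_sub_conv (h : IsAsymptoticAR L N a x U σ₂ α₄) (hψ : lagSeries a * ψ = 1)
    (hsum : Summable fun k => |PowerSeries.coeff k ψ|) {m : ℕ} (hm : m ≤ p) :
    Tendsto (fun q => avg (N q) (fun t =>
      (x q (t - m) - conv (fun k => PowerSeries.coeff k ψ) (U q) (t - m)) ^ 4)) L (𝓝 0) := by
  have h1 := h.tendsto_avg_startErr.const_mul ((∑' k, |PowerSeries.coeff k ψ|) ^ 4)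
  rw [mul_zero] at h1
  have h2 : Tendsto (fun q => avg (N q) (fun t =>
      conv (fun k => PowerSeries.coeff k ψ) (startErr a (x q)) (t - m) ^ 4)) L (𝓝 0) :=
    squeeze_zero (fun q => avg_nonneg fun t => by positivity)
      (fun q => avg_conv_pow_four_le hsum (fun s hs => if_pos hs) _ _) h1
  refine (tendsto_avg_add_pow_four_zero (h.tendsto_avg_start hm) h2).congr fun q =>
    avg_congr fun t _ ht => ?_
  rw [h.sub_conv_eq hψ q (by omega)]

/-- Lagged fourth sample moments are bounded by a convergent quantity. -/
lemma exists_avg_pow_four_le (h : IsAsymptoticAR L N a x U σ₂ α₄) (ha : AssumptionA0 a) :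
    ∃ (V : Q → ℝ) (β : ℝ), Tendsto V L (𝓝 β) ∧
      ∀ q, ∀ m ≤ p, avg (N q) (fun t => x q (t - m) ^ 4) ≤ V q := by
  obtain ⟨ψ, hψ, hsum⟩ := exists_summable_inverse ha
  set c : ℕ → ℝ := fun k => PowerSeries.coeff k ψ
  -- Summing over all lags up to p gives one bound valid for every m.
  have hR := tendsto_finsetSum (Finset.range (p + 1)) fun m hm =>
    h.tendsto_avg_sub_conv hψ hsum (m := m) (by rw [Finset.mem_range] at hm; omega)
  refine ⟨_, _, ((h.fourth.const_mul ((∑' k, |c k|) ^ 4)).add hR).const_mul 8, fun q m hm => ?_⟩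
  have h1 : avg (N q) (fun t => x q (t - m) ^ 4) ≤
      8 * (avg (N q) (fun t => conv c (U q) (t - m) ^ 4) +
        avg (N q) (fun t => (x q (t - m) - conv c (U q) (t - m)) ^ 4)) := by
    rw [← avg_add, ← avg_const_mul]
    refine avg_mono fun t _ _ => ?_
    have := add_pow_four_le (conv c (U q) (t - m)) (x q (t - m) - conv c (U q) (t - m))
    rwa [add_sub_cancel] at this
  refine h1.trans ?_
  gcongr
  · exact avg_conv_pow_four_le hsum (h.err_nonpos q) _ _
  · exact Finset.single_le_sum (f := fun m : ℕ => avg (N q) (fun t =>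
      (x q (t - m) - conv c (U q) (t - m)) ^ 4))
      (fun m _ => avg_nonneg fun t => by positivity) (by simp; omega)

lemma one_sub_sum_ne_zero (ha : AssumptionA0 a) : 1 - ∑ i, a i ≠ 0 := by
  have h := ha 1 (by simp)
  simp only [one_pow, mul_one] at h
  exact_mod_cast h

/-- Lagged sample means vanish asymptotically. -/
lemma tendsto_avg_lag (h : IsAsymptoticAR L N a x U σ₂ α₄) (ha : AssumptionA0 a) {m : ℕ}
    (hm : m ≤ p) : Tendsto (fun q => avg (N q) (fun t => x q (t - m))) L (𝓝 0) := by
  obtain ⟨V, β, hV, hxV⟩ := h.exists_avg_pow_four_le ha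
  have hshift : ∀ m < p, Tendsto (fun q => avg (N q) (fun t => x q (t - m)) -
      avg (N q) (fun t => x q (t - (m + 1 : ℤ)))) L (𝓝 0) := by
    intro m hm
    refine tendsto_avg_shift h.size m (hV.const_add 1) ?_ ?_
    · filter_upwards [h.size.eventually_ne_atTop 0] with q hq
      rw [← avg_const hq 1]
      refine le_trans ?_ (add_le_add_right (hxV q m hm.le) _)
      rw [← avg_add]
      refine avg_mono fun t _ _ => ?_
      nlinarith [sq_nonneg (x q (t - m) ^ 2 - 1)]
    · have h1 := (tendsto_natCast_inv h.size).add (h.start ⟨m, hm⟩)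
      rw [add_zero] at h1
      refine squeeze_zero_norm (fun q => ?_) h1
      have h2 : |x q (-(m : ℤ))| ≤ 1 + x q (-(m : ℤ)) ^ 4 := by
        have : x q (-(m : ℤ)) ^ 4 = (|x q (-(m : ℤ))| ^ 2) ^ 2 := by rw [sq_abs]; ring
        rw [this]
        nlinarith [sq_nonneg (|x q (-(m : ℤ))| ^ 2 - 1), sq_nonneg (|x q (-(m : ℤ))| - 1)]
      rw [norm_mul, Real.norm_eq_abs, Real.norm_eq_abs, abs_of_nonneg (by positivity)]
      calc _ ≤ (N q : ℝ)⁻¹ * (1 + x q (-(m : ℤ)) ^ 4) := by gcongr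
        _ = _ := by ring
  have hdiff : ∀ m ≤ p, Tendsto (fun q => avg (N q) (x q) -
      avg (N q) (fun t => x q (t - m))) L (𝓝 0) := by
    intro m
    induction m with
    | zero => simpa using tendsto_const_nhds
    | succ m ih =>
      intro hm
      have h1 := (ih (by omega)).add (hshift m (by omega))
      rw [add_zero] at h1
      refine h1.congr fun q => ?_
      push_cast
      ring
  -- Averaging the recursion gives (1 - ∑ a_i) x̄ = ū minus vanishing shift corrections; stability
  -- at z = 1 permits the division.
  have h0 : Tendsto (fun q => avg (N q) (x q)) L (𝓝 0) := by
    have h1 : Tendsto (fun q => (1 - ∑ i, a i)⁻¹ * (avg (N q) (U q) - ∑ i : Fin p, a i *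
        (avg (N q) (x q) - avg (N q) (fun t => x q (t - ((i : ℕ) + 1 : ℕ)))))) L (𝓝 0) := by
      have h2 := tendsto_finsetSum (Finset.univ : Finset (Fin p)) fun i _ =>
        (hdiff ((i : ℕ) + 1) (by omega)).const_mul (a i)
      simpa using (h.mean.sub h2).const_mul (1 - ∑ i, a i)⁻¹
    refine h1.congr fun q => ?_
    have h3 : avg (N q) (x q) = ∑ i : Fin p, a i *
        avg (N q) (fun t => x q (t - ((i : ℕ) + 1 : ℕ))) + avg (N q) (U q) := by
      simp only [← avg_const_mul]
      rw [← avg_sum, ← avg_add]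
      refine avg_congr fun t h1 h2 => ?_
      rw [h.recursion q t h1 h2]
      push_cast
      rfl
    rw [inv_mul_eq_iff_eq_mul₀ (one_sub_sum_ne_zero ha)]
    simp only [mul_sub, Finset.sum_sub_distrib, ← Finset.sum_mul]
    linear_combination -h3
  have h4 := h0.sub (hdiff m hm)
  simpa using h4

/-- A shift changes the average only by end terms, which the fourth sample moments make negligible.
-/
lemma tendsto_avg_err_sq_lag (h : IsAsymptoticAR L N a x U σ₂ α₄) (m : ℕ) :
    Tendsto (fun q => avg (N q) (fun t => U q (t - m) ^ 2)) L (𝓝 σ₂) := by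
  induction m with
  | zero => simpa using h.second
  | succ m ih =>
    have h1 := tendsto_avg_shift h.size (f := fun q t => U q t ^ 2) m h.fourth
      (Eventually.of_forall fun q => by
        simp only [← pow_mul]
        exact avg_shift_le (f := fun t => U q t ^ 4) (fun s => by positivity)
          (fun s hs => by simp [h.err_nonpos q s hs]) _ _)
      (by simp [h.err_nonpos, tendsto_const_nhds])
    have h2 := ih.sub h1
    rw [sub_zero] at h2
    refine h2.congr fun q => ?_
    push_cast
    ring

lemma tendsto_avg_err_mul (h : IsAsymptoticAR L N a x U σ₂ α₄) (i l : ℕ) :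
    Tendsto (fun q => avg (N q) (fun t => U q (t - i) * U q (t - l))) L
      (𝓝 (if i = l then σ₂ else 0)) := by
  rcases lt_trichotomy i l with hil | rfl | hil
  · rw [if_neg hil.ne]
    exact h.autocov i l hil
  · rw [if_pos rfl]
    simpa only [sq] using h.tendsto_avg_err_sq_lag i
  · rw [if_neg hil.ne']
    simpa only [mul_comm] using h.autocov l i hil

/-- Terms with k ≥ N vanish, so the growing finite sum becomes a series over a fixed index set,
ready for dominated convergence. -/
lemma avg_err_mul_conv (h : IsAsymptoticAR L N a x U σ₂ α₄) (c : ℕ → ℝ) (q : Q) (i j : ℕ) :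
    avg (N q) (fun t => U q (t - i) * conv c (U q) (t - j)) =
      ∑' k, c k * avg (N q) (fun t => U q (t - i) * U q (t - (j + k : ℕ))) := by
  rw [tsum_eq_sum (s := Finset.range (N q))]
  · simp only [← avg_const_mul]
    rw [← avg_sum]
    refine avg_congr fun t h1 h2 => ?_
    rw [conv, Finset.sum_subset (s₂ := Finset.range (N q)), Finset.mul_sum]
    · refine Finset.sum_congr rfl fun k _ => ?_
      push_cast
      rw [sub_sub]
      ring
    · intro k hk
      rw [Finset.mem_range] at *
      omega
    · intro k _ hk
      rw [Finset.mem_range] at hk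
      rw [h.err_nonpos q _ (by omega), mul_zero]
  · intro k hk
    rw [Finset.mem_range] at hk
    rw [avg_congr (g := fun _ => 0)]
    · simp [avg]
    · intro t _ h2
      rw [h.err_nonpos q (t - (j + k : ℕ)) (by push_cast; omega), mul_zero]

/-- Only k = i - j survives in the limit. Cauchy-Schwarz dominates the terms by |c k| (σ₂ + 1). -/
lemma tendsto_avg_err_mul_conv (h : IsAsymptoticAR L N a x U σ₂ α₄) {c : ℕ → ℝ}
    (hc : Summable fun k => |c k|) (i j : ℕ) :
    Tendsto (fun q => avg (N q) (fun t => U q (t - i) * conv c (U q) (t - j))) L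
      (𝓝 (if j ≤ i then σ₂ * c (i - j) else 0)) := by
  simp only [h.avg_err_mul_conv]
  have hval : (if j ≤ i then σ₂ * c (i - j) else 0) =
      ∑' k, c k * (if i = j + k then σ₂ else 0) := by
    split_ifs with hji
    · rw [tsum_eq_single (i - j) fun k hk => by rw [if_neg (by omega), mul_zero],
        if_pos (by omega), mul_comm]
    · rw [tsum_congr (g := fun _ => 0) fun k => by rw [if_neg (by omega), mul_zero], tsum_zero]
  rw [hval]
  refine tendsto_tsum_of_dominated_convergence (bound := fun k => |c k| * (σ₂ + 1))
    (hc.mul_right _) (fun k => (h.tendsto_avg_err_mul i (j + k)).const_mul (c k)) ?_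
  filter_upwards [h.second.eventually_le_const (lt_add_one σ₂)] with q hq k
  rw [norm_mul, Real.norm_eq_abs, Real.norm_eq_abs]
  gcongr
  have h0 : 0 ≤ avg (N q) (fun t => U q t ^ 2) := avg_nonneg fun t => sq_nonneg _
  have hle : ∀ m : ℕ, avg (N q) (fun t => U q (t - m) ^ 2) ≤ σ₂ + 1 := fun m =>
    (avg_shift_le (f := fun t => U q t ^ 2) (fun s => sq_nonneg _)
      (fun s hs => by simp [h.err_nonpos q s hs]) _ m).trans hq
  refine abs_le_of_sq_le_sq ((avg_mul_sq_le _ _ _).trans ?_) (h0.trans hq)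
  rw [sq]
  exact mul_le_mul (hle _) (hle _) (avg_nonneg fun t => sq_nonneg _) (h0.trans hq)

/-- Limits of the sample cross moments of lagged errors and lagged observations. -/
lemma tendsto_avg_err_mul_lag (h : IsAsymptoticAR L N a x U σ₂ α₄) (hψ : lagSeries a * ψ = 1)
    (hsum : Summable fun k => |PowerSeries.coeff k ψ|) (i : ℕ) {j : ℕ} (hj : j ≤ p) :
    Tendsto (fun q => avg (N q) (fun t => U q (t - i) * x q (t - j))) L
      (𝓝 (if j ≤ i then σ₂ * PowerSeries.coeff (i - j) ψ else 0)) := by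
  have h1 := h.tendsto_avg_err_mul_conv (c := fun k => PowerSeries.coeff k ψ) hsum i j
  have h2 := tendsto_avg_mul_zero (h.tendsto_avg_err_sq_lag i)
    (tendsto_avg_sq_zero h.size (h.tendsto_avg_sub_conv hψ hsum hj))
  have h3 := h1.add h2
  rw [add_zero] at h3
  refine h3.congr fun q => ?_
  rw [← avg_add]
  congr 1
  ext t
  ring

end IsAsymptoticAR

end Autoregression

/-! ### Consistency of least squares -/

section LeastSquares

open Matrix

variable {p : ℕ}

/-- The sample cross moment matrix of the columns of `W` and `X`. -/
def crossMoment (n : ℕ) (W X : Fin p → ℤ → ℝ) : Matrix (Fin p) (Fin p) ℝ :=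
  Matrix.of fun i j => avg n (fun t => W i t * X j t)

lemma crossMoment_mulVec (n : ℕ) (W X : Fin p → ℤ → ℝ) (v : Fin p → ℝ) (i : Fin p) :
    (crossMoment n W X *ᵥ v) i = avg n (fun t => W i t * ∑ j, v j * X j t) := by
  simp only [mulVec, dotProduct, crossMoment, Matrix.of_apply, Finset.mul_sum]
  rw [avg_sum]
  refine Finset.sum_congr rfl fun j _ => ?_
  rw [mul_comm, ← avg_const_mul]
  congr 1
  ext t
  ring

lemma dotProduct_crossMoment (n : ℕ) (X : Fin p → ℤ → ℝ) (v : Fin p → ℝ) :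
    v ⬝ᵥ (crossMoment n X X *ᵥ v) = avg n (fun t => (∑ j, v j * X j t) ^ 2) := by
  simp only [dotProduct, crossMoment_mulVec, ← avg_const_mul]
  rw [← avg_sum]
  congr 1
  ext t
  rw [sq, Finset.sum_mul]
  refine Finset.sum_congr rfl fun j _ => by ring

/-- The quadratic form of the Gram matrix dominates the instrument matrix, which is how
nonsingularity passes from the latter to the former. -/
lemma crossMoment_mulVec_sq_le (n : ℕ) (W X : Fin p → ℤ → ℝ) (v : Fin p → ℝ) (i : Fin p) :
    (crossMoment n W X *ᵥ v) i ^ 2 ≤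
      avg n (fun t => W i t ^ 2) * (v ⬝ᵥ (crossMoment n X X *ᵥ v)) := by
  rw [crossMoment_mulVec, dotProduct_crossMoment]
  exact avg_mul_sq_le _ _ _

/-- A nonsingular cross moment matrix with instruments forces a nonsingular Gram matrix. -/
lemma isUnit_det_crossMoment {n : ℕ} {W X : Fin p → ℤ → ℝ}
    (hM : IsUnit (crossMoment n W X).det) : IsUnit (crossMoment n X X).det := by
  rw [isUnit_iff_ne_zero] at hM ⊢
  intro hdet
  obtain ⟨v, hv, hv0⟩ := Matrix.exists_mulVec_eq_zero_iff.2 hdet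
  refine hM (Matrix.exists_mulVec_eq_zero_iff.1 ⟨v, hv, ?_⟩)
  ext i
  have h := crossMoment_mulVec_sq_le n W X v i
  rw [hv0, dotProduct_zero, mul_zero] at h
  exact pow_eq_zero_iff two_ne_zero |>.1 (le_antisymm h (sq_nonneg _))

/-- The squared norm of the solution of the normal equations is controlled through
instruments. -/
lemma sum_sq_le_of_crossMoment {n : ℕ} {W X : Fin p → ℤ → ℝ}
    (hM : IsUnit (crossMoment n W X).det) (b : Fin p → ℝ) :
    ∑ i, b i ^ 2 ≤ ((∑ i, ∑ j, (crossMoment n W X)⁻¹ i j ^ 2) *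
      ∑ i, avg n (fun t => W i t ^ 2)) ^ 2 * ∑ i, (crossMoment n X X *ᵥ b) i ^ 2 := by
  set M := crossMoment n W X
  set r := crossMoment n X X *ᵥ b with hr
  set K := (∑ i, ∑ j, M⁻¹ i j ^ 2) * ∑ i, avg n (fun t => W i t ^ 2) with hK
  set D := ∑ i, b i ^ 2 with hD
  have hD0 : 0 ≤ D := Finset.sum_nonneg fun i _ => sq_nonneg _
  have hh0 : 0 ≤ b ⬝ᵥ r := by
    rw [hr, dotProduct_crossMoment]
    exact avg_nonneg fun t => sq_nonneg _
  have hK0 : 0 ≤ K := mul_nonneg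
    (Finset.sum_nonneg fun i _ => Finset.sum_nonneg fun j _ => sq_nonneg _)
    (Finset.sum_nonneg fun i _ => avg_nonneg fun t => sq_nonneg _)
  have hb : b = M⁻¹ *ᵥ (M *ᵥ b) := by
    rw [mulVec_mulVec, Matrix.nonsing_inv_mul _ hM, one_mulVec]
  have hMb : ∑ i, (M *ᵥ b) i ^ 2 ≤ (∑ i, avg n (fun t => W i t ^ 2)) * (b ⬝ᵥ r) := by
    rw [Finset.sum_mul]
    exact Finset.sum_le_sum fun i _ => crossMoment_mulVec_sq_le n W X b i
  have h1 : D ≤ K * (b ⬝ᵥ r) := by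
    have hi : ∀ i, b i ^ 2 ≤ (∑ j, M⁻¹ i j ^ 2) * ∑ j, (M *ᵥ b) j ^ 2 := fun i => by
      have h0 : b i = ∑ j, M⁻¹ i j * (M *ᵥ b) j := congrFun hb i
      rw [h0]
      exact Finset.sum_mul_sq_le_sq_mul_sq _ _ _
    calc D ≤ ∑ i, (∑ j, M⁻¹ i j ^ 2) * ∑ j, (M *ᵥ b) j ^ 2 :=
          Finset.sum_le_sum fun i _ => hi i
      _ = (∑ i, ∑ j, M⁻¹ i j ^ 2) * ∑ j, (M *ᵥ b) j ^ 2 := by rw [Finset.sum_mul]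
      _ ≤ (∑ i, ∑ j, M⁻¹ i j ^ 2) *
          ((∑ i, avg n (fun t => W i t ^ 2)) * (b ⬝ᵥ r)) :=
          mul_le_mul_of_nonneg_left hMb
            (Finset.sum_nonneg fun i _ => Finset.sum_nonneg fun j _ => sq_nonneg _)
      _ = K * (b ⬝ᵥ r) := by rw [hK, mul_assoc]
  have h2 : (b ⬝ᵥ r) ^ 2 ≤ D * ∑ i, r i ^ 2 := Finset.sum_mul_sq_le_sq_mul_sq _ _ _
  -- Combine D ≤ K (b·r) with (b·r)² ≤ D |r|², then cancel one factor D.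
  have h3 : D * D ≤ D * (K ^ 2 * ∑ i, r i ^ 2) := by
    calc D * D ≤ (K * (b ⬝ᵥ r)) * (K * (b ⬝ᵥ r)) :=
          mul_self_le_mul_self hD0 h1
      _ = K ^ 2 * (b ⬝ᵥ r) ^ 2 := by ring
      _ ≤ K ^ 2 * (D * ∑ i, r i ^ 2) := by gcongr
      _ = _ := by ring
  rcases hD0.eq_or_lt with h0 | h0
  · rw [← h0]
    have := Finset.sum_nonneg fun i (_ : i ∈ Finset.univ) => sq_nonneg (r i)
    positivity
  · exact le_of_mul_le_mul_left h3 h0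

/-- The lagged centred observations as regressors. -/
def regressor (p : ℕ) (y : ℤ → ℝ) (w : ℝ) (i : Fin p) (t : ℤ) : ℝ :=
  xC y w (t - ((i : ℕ) + 1 : ℤ))

lemma sigmaLag_eq (p n : ℕ) (y : ℤ → ℝ) (w : ℝ) :
    sigmaLag p n y w = crossMoment n (regressor p y w) (regressor p y w) := by
  ext i j
  simp [sigmaLag, crossMoment, avg, regressor, lagVec, Matrix.sum_apply, vecMulVec_apply]

lemma sigmaCross_apply (p n : ℕ) (y : ℤ → ℝ) (w : ℝ) (i : Fin p) :
    sigmaCross p n y w i = avg n (fun t => regressor p y w i t * xC y w t) := by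
  simp [sigmaCross, avg, regressor, lagVec, mul_comm]

/-- The normal equations for the estimation error. -/
lemma sigmaLag_mulVec_sub {n : ℕ} {y : ℤ → ℝ} {w : ℝ} (h : IsUnit (sigmaLag p n y w).det)
    (a : Fin p → ℝ) (i : Fin p) :
    (sigmaLag p n y w *ᵥ (thetaHat p n y w - a)) i = avg n (fun t => regressor p y w i t *
      (xC y w t - ∑ j, a j * regressor p y w j t)) := by
  rw [mulVec_sub, thetaHat, mulVec_mulVec, Matrix.mul_nonsing_inv _ h, one_mulVec,
    Pi.sub_apply, sigmaCross_apply, sigmaLag_eq, crossMoment_mulVec, ← avg_sub]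
  simp only [mul_sub]

variable {Q : Type*} {L : Filter Q} {N : Q → ℕ} {a : Fin p → ℝ} {x U y : Q → ℤ → ℝ}
  {σ₂ α₄ ω₀ : ℝ}

namespace IsAsymptoticAR

lemma tendsto_omegaHat (h : IsAsymptoticAR L N a x U σ₂ α₄) (ha : AssumptionA0 a)
    (hy : ∀ q t, y q t = ω₀ + x q t) :
    Tendsto (fun q => omegaHat (N q) (y q) - ω₀) L (𝓝 0) := by
  refine (h.tendsto_avg_lag ha (Nat.zero_le p)).congr' ?_
  filter_upwards [h.size.eventually_ne_atTop 0] with q hq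
  have h1 : omegaHat (N q) (y q) = avg (N q) (fun t => ω₀ + x q t) := by
    simp only [← hy]
    rfl
  rw [h1, avg_add, avg_const hq]
  simp

lemma xC_eq (hy : ∀ q t, y q t = ω₀ + x q t) (q : Q) (t : ℤ) :
    xC (y q) (omegaHat (N q) (y q)) t = x q t - (omegaHat (N q) (y q) - ω₀) := by
  rw [xC, hy]
  ring

/-- Cross moments with lagged errors as instruments. -/
lemma tendsto_avg_err_mul_regressor (h : IsAsymptoticAR L N a x U σ₂ α₄) (ha : AssumptionA0 a)
    (hy : ∀ q t, y q t = ω₀ + x q t) {ψ : PowerSeries ℝ} (hψ : lagSeries a * ψ = 1)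
    (hsum : Summable fun k => |PowerSeries.coeff k ψ|) (i : ℕ) (j : Fin p) :
    Tendsto (fun q => avg (N q) (fun t => U q (t - i) *
      regressor p (y q) (omegaHat (N q) (y q)) j t)) L
      (𝓝 (if (j : ℕ) + 1 ≤ i then σ₂ * PowerSeries.coeff (i - (j + 1)) ψ else 0)) := by
  have hd := h.tendsto_omegaHat ha hy
  have h1 := h.tendsto_avg_err_mul_lag hψ hsum i (j := (j : ℕ) + 1) (by omega)
  have h2 : Tendsto (fun q => (omegaHat (N q) (y q) - ω₀) *
      avg (N q) (fun t => U q (t - i))) L (𝓝 0) := by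
    refine tendsto_zero_of_sq_le (b := fun q => (omegaHat (N q) (y q) - ω₀) ^ 2 *
      avg (N q) (fun t => U q (t - i) ^ 2)) ?_ ?_
    · simpa using (hd.pow 2).mul (h.tendsto_avg_err_sq_lag i)
    · filter_upwards [h.size.eventually_ne_atTop 0] with q hq
      rw [mul_pow]
      gcongr
      exact avg_sq_le hq _
  have h3 := h1.sub h2
  rw [sub_zero] at h3
  refine h3.congr fun q => ?_
  rw [← avg_const_mul, ← avg_sub]
  congr 1
  ext t
  rw [regressor, xC_eq hy]
  push_cast
  ring

/-- The limit of the instrumental cross moment matrix is lower triangular and nonsingular. -/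
lemma exists_tendsto_crossMoment (h : IsAsymptoticAR L N a x U σ₂ α₄) (ha : AssumptionA0 a)
    (hσ : 0 < σ₂) (hy : ∀ q t, y q t = ω₀ + x q t) :
    ∃ T : Matrix (Fin p) (Fin p) ℝ, T.det ≠ 0 ∧
      Tendsto (fun q => crossMoment (N q) (fun i t => U q (t - ((i : ℕ) + 1 : ℕ)))
        (regressor p (y q) (omegaHat (N q) (y q)))) L (𝓝 T) := by
  obtain ⟨ψ, hψ, hsum⟩ := exists_summable_inverse ha
  -- This makes each diagonal entry of the limit equal to σ₂. Above the diagonal the error is later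
  -- than the regressor, so the entry is 0.
  have hψ0 : PowerSeries.coeff 0 ψ = 1 := by
    have h1 := congrArg (PowerSeries.coeff 0) hψ
    rw [coeff_lagSeries_mul] at h1
    simpa using h1
  refine ⟨Matrix.of fun i j : Fin p => if (j : ℕ) + 1 ≤ (i : ℕ) + 1 then
    σ₂ * PowerSeries.coeff ((i : ℕ) + 1 - (j + 1)) ψ else 0, ?_, ?_⟩
  · rw [Matrix.det_of_isLowerTriangular _ fun i j hij => ?_]
    · refine Finset.prod_ne_zero_iff.2 fun i _ => ?_
      simp [hψ0, hσ.ne']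
    · have hij' : (i : ℕ) < j := by simpa using hij
      rw [Matrix.of_apply, if_neg (by omega)]
  · refine tendsto_pi_nhds.2 fun i => tendsto_pi_nhds.2 fun j => ?_
    exact h.tendsto_avg_err_mul_regressor ha hy hψ hsum _ j

/-- The least squares estimator is consistent. -/
lemma tendsto_thetaHat (h : IsAsymptoticAR L N a x U σ₂ α₄) (ha : AssumptionA0 a)
    (hσ : 0 < σ₂) (hy : ∀ q t, y q t = ω₀ + x q t) (i : Fin p) :
    Tendsto (fun q => thetaHat p (N q) (y q) (omegaHat (N q) (y q)) i - a i) L (𝓝 0) := by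
  obtain ⟨T, hT, hM⟩ := h.exists_tendsto_crossMoment ha hσ hy
  obtain ⟨ψ, hψ, hsum⟩ := exists_summable_inverse ha
  have hd := h.tendsto_omegaHat ha hy
  set d : Q → ℝ := fun q => omegaHat (N q) (y q) - ω₀ with hd_def
  set W : Q → Fin p → ℤ → ℝ := fun q i t => U q (t - ((i : ℕ) + 1 : ℕ))
  set X : Q → Fin p → ℤ → ℝ := fun q => regressor p (y q) (omegaHat (N q) (y q)) with hX
  have hdet : Tendsto (fun q => (crossMoment (N q) (W q) (X q)).det) L (𝓝 T.det) :=
    ((Continuous.matrix_det continuous_id).tendsto T).comp hM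
  have hinv : Tendsto (fun q => (crossMoment (N q) (W q) (X q))⁻¹) L (𝓝 T⁻¹) := by
    simp only [Matrix.inv_def, Ring.inverse_eq_inv']
    exact (hdet.inv₀ hT).smul
      (((Continuous.matrix_adjugate continuous_id).tendsto T).comp hM)
  have hent : ∀ i j, Tendsto (fun q => (crossMoment (N q) (W q) (X q))⁻¹ i j) L (𝓝 (T⁻¹ i j)) :=
    fun i j => tendsto_pi_nhds.1 (tendsto_pi_nhds.1 hinv i) j
  have hK : Tendsto (fun q => ((∑ i, ∑ j, (crossMoment (N q) (W q) (X q))⁻¹ i j ^ 2) *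
      ∑ i, avg (N q) (fun t => W q i t ^ 2)) ^ 2) L
      (𝓝 (((∑ i, ∑ j, T⁻¹ i j ^ 2) * ∑ _i : Fin p, σ₂) ^ 2)) :=
    ((tendsto_finsetSum _ fun i _ => tendsto_finsetSum _ fun j _ => (hent i j).pow 2).mul
      (tendsto_finsetSum _ fun i _ => h.tendsto_avg_err_sq_lag _)).pow 2
  -- At the true parameter the centred recursion has error U - (1 - ∑ a_j) d. The current error is
  -- asymptotically orthogonal to every regressor, and d vanishes.
  have hr : ∀ i, Tendsto (fun q => avg (N q) (fun t => X q i t *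
      (U q t - (1 - ∑ j, a j) * d q))) L (𝓝 0) := fun i => by
    have h1 := h.tendsto_avg_err_mul_regressor ha hy hψ hsum 0 i
    simp only [Nat.le_zero, Nat.succ_ne_zero, if_false, Nat.cast_zero, sub_zero] at h1
    have h2 : Tendsto (fun q => avg (N q) (X q i)) L (𝓝 0) := by
      have h3 := (h.tendsto_avg_lag ha (m := (i : ℕ) + 1) (by omega)).sub hd
      rw [sub_zero] at h3
      refine h3.congr' ?_
      filter_upwards [h.size.eventually_ne_atTop 0] with q hq
      rw [← avg_const hq (d q), ← avg_sub]
      refine avg_congr fun t _ _ => ?_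
      simp only [hX, regressor]
      rw [xC_eq hy]
      push_cast
      rfl
    have h4 := h1.sub ((hd.const_mul (1 - ∑ j, a j)).mul h2)
    simp only [mul_zero, sub_zero] at h4
    refine h4.congr fun q => ?_
    rw [← avg_const_mul, ← avg_sub]
    congr 1
    ext t
    ring
  have hr2 : Tendsto (fun q => ∑ i, avg (N q) (fun t => X q i t *
      (U q t - (1 - ∑ j, a j) * d q)) ^ 2) L (𝓝 0) := by
    simpa using tendsto_finsetSum (Finset.univ : Finset (Fin p)) fun i _ => (hr i).pow 2
  have hlim := hK.mul hr2
  rw [mul_zero] at hlim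
  refine tendsto_zero_of_sq_le hlim ?_
  -- The inverse in `thetaHat` is meaningful only for an invertible Gram matrix, which is guaranteed
  -- eventually.
  filter_upwards [hdet.eventually_ne hT] with q hq
  have hu : IsUnit (crossMoment (N q) (W q) (X q)).det := isUnit_iff_ne_zero.2 hq
  have h1 := sum_sq_le_of_crossMoment hu
    (thetaHat p (N q) (y q) (omegaHat (N q) (y q)) - a)
  have hS : IsUnit (sigmaLag p (N q) (y q) (omegaHat (N q) (y q))).det := by
    rw [sigmaLag_eq]
    exact isUnit_det_crossMoment hu
  have hS' : crossMoment (N q) (X q) (X q) =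
      sigmaLag p (N q) (y q) (omegaHat (N q) (y q)) := (sigmaLag_eq _ _ _ _).symm
  rw [hS'] at h1
  simp only [sigmaLag_mulVec_sub hS] at h1
  refine le_trans (Finset.single_le_sum (f := fun i =>
    (thetaHat p (N q) (y q) (omegaHat (N q) (y q)) - a) i ^ 2)
    (fun i _ => sq_nonneg _) (Finset.mem_univ i)) (h1.trans (le_of_eq ?_))
  congr 1
  refine Finset.sum_congr rfl fun j _ => ?_
  congr 1
  refine avg_congr fun t ht1 ht2 => ?_
  simp only [hX]
  congr 1
  simp only [regressor, xC_eq hy]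
  rw [h.recursion q t ht1 ht2]
  simp only [mul_sub, Finset.sum_sub_distrib, ← Finset.sum_mul, hd_def]
  ring

/-- The centred moments of the residuals have the limits of the moments of the errors. -/
lemma tendsto_muHat (h : IsAsymptoticAR L N a x U σ₂ α₄) (ha : AssumptionA0 a)
    (hσ : 0 < σ₂) (hy : ∀ q t, y q t = ω₀ + x q t) {j : ℕ} {α : ℝ} (hj2 : 2 ≤ j) (hj4 : j ≤ 4)
    (hj : Tendsto (fun q => avg (N q) (fun t => U q t ^ j)) L (𝓝 α)) :
    Tendsto (fun q => muHat p (N q) (y q) j) L (𝓝 α) := by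
  obtain ⟨V, β, hV, hxV⟩ := h.exists_avg_pow_four_le ha
  set δ : Q → Fin p → ℝ := fun q i => thetaHat p (N q) (y q) (omegaHat (N q) (y q)) i - a i
    with hδ_def
  have hδ : ∀ i, Tendsto (fun q => δ q i) L (𝓝 0) := fun i => h.tendsto_thetaHat ha hσ hy i
  set e : Q → ℤ → ℝ := fun q t => ∑ i, δ q i * x q (t - ((i : ℕ) + 1 : ℕ)) with he_def
  have he : Tendsto (fun q => avg (N q) (fun t => e q t ^ 4)) L (𝓝 0) := by
    refine tendsto_avg_sum_pow_four_zero Finset.univ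
      (f := fun i q t => δ q i * x q (t - ((i : ℕ) + 1 : ℕ))) fun i _ => ?_
    refine squeeze_zero (g := fun q => δ q i ^ 4 * V q)
      (fun q => avg_nonneg fun t => by positivity) (fun q => ?_) ?_
    · simp only [mul_pow, avg_const_mul]
      exact mul_le_mul_of_nonneg_left (hxV q _ (by omega)) (by positivity)
    · simpa using ((hδ i).pow 4).mul hV
  have hebar : Tendsto (fun q => avg (N q) (U q) - avg (N q) (e q)) L (𝓝 0) := by
    simpa using h.mean.sub (tendsto_avg_zero h.size (tendsto_avg_sq_zero h.size he))
  have hc : Tendsto (fun q => avg (N q) (fun _ => (avg (N q) (U q) - avg (N q) (e q)) ^ 4)) L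
      (𝓝 0) := by
    have h1 := hebar.pow 4
    rw [zero_pow (by norm_num)] at h1
    refine h1.congr' ?_
    filter_upwards [h.size.eventually_ne_atTop 0] with q hq
    rw [avg_const hq]
  refine (tendsto_avg_sub_pow h.size h.second h.fourth (tendsto_avg_add_pow_four_zero he hc)
    hj2 hj4 hj).congr' ?_
  filter_upwards [h.size.eventually_ne_atTop 0] with q hq
  -- The effect of replacing ω₀ by ω̂ does not depend on t, so centring the residuals removes it.
  obtain ⟨k, hk⟩ : ∃ k : ℝ, ∀ t : ℕ, 1 ≤ t → t ≤ N q →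
      uHat p (N q) (y q) t = U q t - e q t - k := by
    refine ⟨(1 - ∑ i, thetaHat p (N q) (y q) (omegaHat (N q) (y q)) i) *
      (omegaHat (N q) (y q) - ω₀), fun t h1 h2 => ?_⟩
    simp only [uHat, lagVec, xC_eq hy, he_def, hδ_def]
    rw [h.recursion q t h1 h2]
    push_cast
    simp only [mul_sub, sub_mul, Finset.sum_sub_distrib, ← Finset.sum_mul]
    ring
  have hbar : uBar p (N q) (y q) = avg (N q) (U q) - avg (N q) (e q) - k := by
    calc uBar p (N q) (y q) = avg (N q) (uHat p (N q) (y q)) := rfl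
      _ = avg (N q) (fun t => U q t - e q t - k) := avg_congr hk
      _ = _ := by rw [avg_sub, avg_sub, avg_const hq]
  change _ = avg (N q) (fun t => (uHat p (N q) (y q) t - uBar p (N q) (y q)) ^ j)
  refine avg_congr fun t h1 h2 => ?_
  rw [hk t h1 h2, hbar]
  ring

end IsAsymptoticAR

end LeastSquares

/-! ### The Jarque-Bera statistic -/

section Statistic

lemma BoundedInProbability.sub_const {Ω : Type*} [MeasurableSpace Ω] {P : Measure Ω}
    {Z : ℕ → Ω → ℝ} (h : BoundedInProbability P Z) (c : ℝ) :
    BoundedInProbability P (fun n ω => Z n ω - c) := by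
  intro δ hδ
  obtain ⟨M, hM⟩ := h δ hδ
  refine ⟨M + |c|, hM.mono fun n hn => (measure_mono fun ω hω => ?_).trans hn⟩
  have h1 : M + |c| < |Z n ω - c| := hω
  have h2 := abs_sub (Z n ω) c
  change M < |Z n ω|
  linarith

variable {Ω : Type*} [MeasurableSpace Ω] {P : Measure Ω} [IsProbabilityMeasure P] {p : ℕ}
  {ω₀ : ℝ} {a : Fin p → ℝ} {g : ℝ → ℝ} {ε : ℕ → Ω → ℝ} {y : ℕ → ℤ → Ω → ℝ}

lemma IsHeteroscedasticAR.isAsymptoticAR (hy : IsHeteroscedasticAR P ω₀ a g ε y)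
    (hg : AssumptionA1i g) (hε : AssumptionA1ii P ε)
    (hstart : ∀ j : Fin p, BoundedInProbability P (fun n ω => y n (-((j : ℕ) : ℤ)) ω - ω₀)) :
    IsAsymptoticAR (inProb P) Prod.fst a (fun q t => y q.1 t q.2 - ω₀)
      (fun q t => err g ε q.1 t q.2) (∫ r in (0 : ℝ)..1, g r ^ 2)
      ((∫ r in (0 : ℝ)..1, g r ^ 4) * ∫ ω, ε 1 ω ^ 4 ∂P) where
  size := tendsto_fst_inProb
  recursion q t h1 h2 := by
    rw [err_of_mem g ε h1 h2]
    exact hy.recursion q.1 t h1 h2 q.2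
  start j := tendsto_inv_mul_of_boundedInProbability
    (Z := fun n ω => y n (-((j : ℕ) : ℤ)) ω - ω₀) (hstart j)
  err_nonpos q s hs := err_of_nonpos g ε q.1 hs q.2
  mean := by
    have h := tendsto_avg_err_pow (P := P) hg hε (j := 1) le_rfl (by norm_num)
    have h1 : ∫ ω, ε 1 ω ∂P = 0 := hε.mean 1
    simpa only [pow_one, h1, mul_zero] using h
  second := by
    have h := tendsto_avg_err_pow (P := P) hg hε (j := 2) (by norm_num) (by norm_num)
    simpa only [hε.variance 1, mul_one] using h
  fourth := tendsto_avg_err_pow (P := P) hg hε (j := 4) (by norm_num) le_rfl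
  autocov i l hil := tendsto_avg_err_mul_of_lt (P := P) hg hε hil

lemma IsHeteroscedasticAR.tendsto_muHat (hy : IsHeteroscedasticAR P ω₀ a g ε y)
    (ha : AssumptionA0 a) (hg : AssumptionA1i g) (hε : AssumptionA1ii P ε) {j : ℕ}
    (hj2 : 2 ≤ j) (hj4 : j ≤ 4) :
    Tendsto (fun q : ℕ × Ω => muHat p q.1 (fun t => y q.1 t q.2) j) (inProb P)
      (𝓝 ((∫ r in (0 : ℝ)..1, g r ^ j) * ∫ ω, ε 1 ω ^ j ∂P)) := by
  have h0 : ∀ j : Fin p,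
      BoundedInProbability P (fun n ω => y n (-((j : ℕ) : ℤ)) ω - ω₀) := fun j =>
    (hy.start_bounded j).sub_const ω₀
  have h := hy.isAsymptoticAR hg hε h0
  have hj := tendsto_avg_err_pow (P := P) hg hε (by omega : 1 ≤ j) hj4
  have hy' : ∀ (q : ℕ × Ω) (t : ℤ), y q.1 t q.2 = ω₀ + (y q.1 t q.2 - ω₀) := fun q t => by ring
  have hσ := hg.integral_sq_pos
  exact IsAsymptoticAR.tendsto_muHat h ha hσ hy' hj2 hj4 hj

/-- The probability limit of the skewness part. -/
def skewnessLimit (g : ℝ → ℝ) (m₃ : ℝ) : ℝ :=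
  ((∫ r in (0 : ℝ)..1, g r ^ 3) * m₃) ^ 2 / (6 * (∫ r in (0 : ℝ)..1, g r ^ 2) ^ 3)

lemma skewnessLimit_nonneg (hg : AssumptionA1i g) (m₃ : ℝ) : 0 ≤ skewnessLimit g m₃ := by
  have := hg.integral_sq_pos
  unfold skewnessLimit
  positivity

lemma IsHeteroscedasticAR.tendsto_QS (hy : IsHeteroscedasticAR P ω₀ a g ε y)
    (ha : AssumptionA0 a) (hg : AssumptionA1i g) (hε : AssumptionA1ii P ε) :
    Tendsto (fun q : ℕ × Ω => QS p q.1 (fun t => y q.1 t q.2)) (inProb P)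
      (𝓝 (skewnessLimit g (∫ ω, ε 1 ω ^ 3 ∂P))) := by
  have hpos := hg.integral_sq_pos
  have h2 := hy.tendsto_muHat ha hg hε (j := 2) le_rfl (by norm_num)
  have h3 := hy.tendsto_muHat ha hg hε (j := 3) (by norm_num) (by norm_num)
  rw [hε.variance 1, mul_one] at h2
  exact (h3.pow 2).div ((h2.pow 3).const_mul 6) (by positivity)

lemma IsHeteroscedasticAR.tendsto_QK (hy : IsHeteroscedasticAR P ω₀ a g ε y)
    (ha : AssumptionA0 a) (hg : AssumptionA1i g) (hε : AssumptionA1ii P ε) :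
    Tendsto (fun q : ℕ × Ω => QK p q.1 (fun t => y q.1 t q.2)) (inProb P)
      (𝓝 (kurtosisLimit g (∫ ω, ε 1 ω ^ 4 ∂P))) := by
  have hpos := hg.integral_sq_pos
  have h2 := hy.tendsto_muHat ha hg hε (j := 2) le_rfl (by norm_num)
  have h4 := hy.tendsto_muHat ha hg hε (j := 4) (by norm_num) le_rfl
  rw [hε.variance 1, mul_one] at h2
  have h := (((h4.div (h2.pow 2) (by positivity)).sub_const 3).pow 2).const_mul (1 / 24)
  have heq : kurtosisLimit g (∫ ω, ε 1 ω ^ 4 ∂P) =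
      1 / 24 * ((∫ r in (0 : ℝ)..1, g r ^ 4) * (∫ ω, ε 1 ω ^ 4 ∂P) /
        (∫ r in (0 : ℝ)..1, g r ^ 2) ^ 2 - 3) ^ 2 := by
    rw [kurtosisLimit, kappa2]
    ring
  rw [heq]
  exact h

lemma IsHeteroscedasticAR.tendsto_QJB_sub_div (hy : IsHeteroscedasticAR P ω₀ a g ε y)
    (ha : AssumptionA0 a) (hg : AssumptionA1i g) (hε : AssumptionA1ii P ε) {C : ℝ}
    (hC : C = skewnessLimit g (∫ ω, ε 1 ω ^ 3 ∂P) + kurtosisLimit g (∫ ω, ε 1 ω ^ 4 ∂P)) :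
    Tendsto (fun q : ℕ × Ω => (QJB p q.1 (fun t => y q.1 t q.2) - C * q.1) / q.1) (inProb P)
      (𝓝 0) := by
  have h := ((hy.tendsto_QS ha hg hε).add (hy.tendsto_QK ha hg hε)).sub_const C
  rw [← hC, sub_self] at h
  refine h.congr' ?_
  filter_upwards [eventually_inProb_of_atTop (eventually_ne_atTop 0)] with q hq
  have : (q.1 : ℝ) ≠ 0 := by exact_mod_cast hq
  rw [QJB]
  field_simp

/-- The test rejects with probability tending to one when its normalized limit is positive. -/
lemma IsHeteroscedasticAR.tendsto_measure_lt_QJB (hy : IsHeteroscedasticAR P ω₀ a g ε y)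
    (ha : AssumptionA0 a) (hg : AssumptionA1i g) (hε : AssumptionA1ii P ε)
    (hC : 0 < skewnessLimit g (∫ ω, ε 1 ω ^ 3 ∂P) + kurtosisLimit g (∫ ω, ε 1 ω ^ 4 ∂P))
    (c : ℝ) : Tendsto (fun n => P {ω | c < QJB p n (fun t => y n t ω)}) atTop (𝓝 1) := by
  have h := (tendsto_natCast_atTop_atTop.comp (tendsto_fst_inProb (P := P))).atTop_mul_pos hC
    ((hy.tendsto_QS ha hg hε).add (hy.tendsto_QK ha hg hε))
  exact tendsto_measure_one_of_eventually_inProb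
    (p := fun q => c < QJB p q.1 (fun t => y q.1 t q.2)) (h.eventually_gt_atTop c)

lemma kurtosisLimit_pos (hg : 1 < kappa2 g) {m₄ : ℝ} (hm : 3 ≤ m₄) : 0 < kurtosisLimit g m₄ := by
  have h1 : 0 ≤ kappa2 g * (m₄ - 3) := mul_nonneg (by linarith) (by linarith)
  have h2 : 0 < kappa2 g * (m₄ - 3) + 3 * (kappa2 g - 1) := by linarith
  unfold kurtosisLimit
  positivity

lemma kurtosisLimit_three (g : ℝ → ℝ) : kurtosisLimit g 3 = 3 / 8 * (kappa2 g - 1) ^ 2 := by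
  rw [kurtosisLimit]
  ring

end Statistic

/-! ### Moments of the standard normal distribution -/

section Gaussian

/-- Moments are the derivatives at 0 of the moment generating function exp(t²/2). -/
lemma integral_pow_gaussianReal (k : ℕ) :
    ∫ x, x ^ k ∂(gaussianReal 0 1) = iteratedDeriv k (fun t : ℝ => Real.exp (t ^ 2 / 2)) 0 := by
  have h := iteratedDeriv_mgf_zero (X := id) (μ := gaussianReal 0 1) (by simp) k
  have h1 : mgf id (gaussianReal 0 1) = fun t : ℝ => Real.exp (t ^ 2 / 2) := by
    rw [mgf_id_gaussianReal]
    simp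
  rw [h1] at h
  rw [h]
  rfl

lemma deriv_mul_exp_sq (f f' : ℝ → ℝ) (hf : ∀ t, HasDerivAt f (f' t) t) :
    deriv (fun t : ℝ => f t * Real.exp (t ^ 2 / 2)) =
      fun t => (f' t + t * f t) * Real.exp (t ^ 2 / 2) := by
  ext t
  have h1 : HasDerivAt (fun t : ℝ => Real.exp (t ^ 2 / 2)) (Real.exp (t ^ 2 / 2) * t) t := by
    have h2 : HasDerivAt (fun t : ℝ => t ^ 2 / 2) t t := by
      have := (hasDerivAt_pow 2 t).div_const 2
      simpa using this
    exact h2.exp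
  have h3 : HasDerivAt (fun t : ℝ => f t * Real.exp (t ^ 2 / 2)) _ t := (hf t).mul h1
  rw [h3.deriv]
  ring

lemma iteratedDeriv_three_exp_sq :
    iteratedDeriv 3 (fun t : ℝ => Real.exp (t ^ 2 / 2)) =
      fun t => (3 * t + t ^ 3) * Real.exp (t ^ 2 / 2) := by
  have h1 : deriv (fun t : ℝ => Real.exp (t ^ 2 / 2)) =
      fun t => t * Real.exp (t ^ 2 / 2) := by
    have := deriv_mul_exp_sq (fun _ => 1) (fun _ => 0) fun t => hasDerivAt_const t 1
    simpa using this
  have h2 := deriv_mul_exp_sq (fun t => t) (fun _ => 1) fun t => hasDerivAt_id t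
  have h3 := deriv_mul_exp_sq (fun t => 1 + t * t) (fun t => 1 * t + t * 1) fun t =>
    ((hasDerivAt_id t).mul (hasDerivAt_id t)).const_add 1
  rw [iteratedDeriv_succ, iteratedDeriv_succ, iteratedDeriv_one, h1, h2, h3]
  ext t
  ring

lemma integral_pow_three_gaussianReal : ∫ x, x ^ 3 ∂(gaussianReal 0 1) = 0 := by
  rw [integral_pow_gaussianReal, iteratedDeriv_three_exp_sq]
  simp

lemma integral_pow_four_gaussianReal : ∫ x, x ^ 4 ∂(gaussianReal 0 1) = 3 := by
  have h := deriv_mul_exp_sq (fun t => 3 * t + t ^ 3) (fun t => 3 * 1 + (3 : ℕ) * t ^ 2) fun t =>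
    ((hasDerivAt_id t).const_mul 3).add (hasDerivAt_pow 3 t)
  rw [integral_pow_gaussianReal, iteratedDeriv_succ, iteratedDeriv_three_exp_sq, h]
  simp

end Gaussian

end JarqueBera

end

theorem mainTheorem2 {Ω : Type*} [MeasurableSpace Ω] (P : Measure Ω) [IsProbabilityMeasure P]
    (p : ℕ) (ω₀ : ℝ) (a : Fin p → ℝ) (g : ℝ → ℝ) (ε : ℕ → Ω → ℝ) (y : ℕ → ℤ → Ω → ℝ)
    (hA0 : JarqueBera.AssumptionA0 a)
    (hA1i : JarqueBera.AssumptionA1i g)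
    (hA1ii : JarqueBera.AssumptionA1ii P ε)
    (hy : JarqueBera.IsHeteroscedasticAR P ω₀ a g ε y)
    (hg : ¬ ∃ k : ℝ, ∀ᵐ r ∂(volume.restrict (Set.Ioc (0 : ℝ) 1)), g r = k) :
    -- the kurtosis part converges in probability
    TendstoInMeasure P (fun n ω => JarqueBera.QK p n (fun t => y n t ω)) atTop
      (fun _ => JarqueBera.kurtosisLimit g (∫ ω, ε 1 ω ^ 4 ∂P)) ∧
    -- positivity of the limit
    1 < JarqueBera.kappa2 g ∧
    (3 ≤ ∫ ω, ε 1 ω ^ 4 ∂P → 0 < JarqueBera.kurtosisLimit g (∫ ω, ε 1 ω ^ 4 ∂P)) ∧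
    -- linear divergence and spurious rejection when the innovations have kurtosis `3`
    ((∫ ω, ε 1 ω ^ 4 ∂P) = 3 →
      (∃ C : ℝ, 0 < C ∧
        TendstoInMeasure P
          (fun n ω => (JarqueBera.QJB p n (fun t => y n t ω) - C * n) / n) atTop
          (fun _ => (0 : ℝ))) ∧
      ∀ q : ℝ, Tendsto (fun n => P {ω | q < JarqueBera.QJB p n (fun t => y n t ω)})
        atTop (𝓝 1)) ∧
    -- the Gaussian case
    (P.map (ε 1) = gaussianReal 0 1 →
      0 < 3 / 8 * (JarqueBera.kappa2 g - 1) ^ 2 ∧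
      TendstoInMeasure P
        (fun n ω => (JarqueBera.QJB p n (fun t => y n t ω) -
          3 / 8 * (JarqueBera.kappa2 g - 1) ^ 2 * n) / n) atTop
        (fun _ => (0 : ℝ)) ∧
      ∀ q : ℝ, Tendsto (fun n => P {ω | q < JarqueBera.QJB p n (fun t => y n t ω)})
        atTop (𝓝 1)) := by
  have hκ : 1 < JarqueBera.kappa2 g := JarqueBera.one_lt_kappa2 hA1i hg
  have hpos : 3 ≤ ∫ ω, ε 1 ω ^ 4 ∂P →
      0 < JarqueBera.kurtosisLimit g (∫ ω, ε 1 ω ^ 4 ∂P) := JarqueBera.kurtosisLimit_pos hκ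
  -- The third moment is not assumed zero, so C includes a nonnegative skewness term; it disappears
  -- in the Gaussian case.
  have hsum : (∫ ω, ε 1 ω ^ 4 ∂P) = 3 → 0 < JarqueBera.skewnessLimit g (∫ ω, ε 1 ω ^ 3 ∂P) +
      JarqueBera.kurtosisLimit g (∫ ω, ε 1 ω ^ 4 ∂P) := fun h =>
    add_pos_of_nonneg_of_pos (JarqueBera.skewnessLimit_nonneg hA1i _) (hpos h.ge)
  refine ⟨JarqueBera.tendstoInMeasure_of_tendsto_inProb (hy.tendsto_QK hA0 hA1i hA1ii), hκ, hpos,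
    fun h4 => ⟨⟨_, hsum h4, JarqueBera.tendstoInMeasure_of_tendsto_inProb
      (hy.tendsto_QJB_sub_div hA0 hA1i hA1ii rfl)⟩,
      hy.tendsto_measure_lt_QJB hA0 hA1i hA1ii (hsum h4)⟩, fun hgauss => ?_⟩
  have hmom : ∀ k : ℕ, ∫ ω, ε 1 ω ^ k ∂P = ∫ x, x ^ k ∂(gaussianReal 0 1) := fun k => by
    rw [← hgauss, integral_map (hA1ii.measurable 1).aemeasurable (by fun_prop)]
  have h3 : ∫ ω, ε 1 ω ^ 3 ∂P = 0 := (hmom 3).trans JarqueBera.integral_pow_three_gaussianReal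
  have h4 : ∫ ω, ε 1 ω ^ 4 ∂P = 3 := (hmom 4).trans JarqueBera.integral_pow_four_gaussianReal
  have hC : 3 / 8 * (JarqueBera.kappa2 g - 1) ^ 2 =
      JarqueBera.skewnessLimit g (∫ ω, ε 1 ω ^ 3 ∂P) +
        JarqueBera.kurtosisLimit g (∫ ω, ε 1 ω ^ 4 ∂P) := by
    rw [h3, h4, JarqueBera.kurtosisLimit_three]
    simp [JarqueBera.skewnessLimit]
  exact ⟨hC ▸ hsum h4, JarqueBera.tendstoInMeasure_of_tendsto_inProb
    (hy.tendsto_QJB_sub_div hA0 hA1i hA1ii hC),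
    hy.tendsto_measure_lt_QJB hA0 hA1i hA1ii (hsum h4)⟩
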